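/- Let $t_0<\vartheta$, $h>0$, and let $\mathbb U\subset\mathbb R^m$ be a nonempty compact set. Call $x\colon[a,b]\to\mathbb R^n$ piecewise continuous, $x\in \mathrm{PC}([a,b],\mathbb R^n)$, if there are $a=\xi_1<\dots<\xi_k=b$ such that, for each $i<k$, $x$ is continuous on $[\xi_i,\xi_{i+1})$ and has a finite limit from the left at $\xi_{i+1}$. Put $\mathrm{PC}=\mathrm{PC}([-h,0],\mathbb R^n)$, $\mathbb G=[t_0,\vartheta]\times\mathbb R^n\times\mathrm{PC}$, $\|w\|_1=\int_{-h}^0\|w(\xi)\|\,d\xi$, $\|w\|_\infty=\sup_{[-h,0]}\|w\|$, and $P(\alpha)=\{(z,w)\in\mathbb R^n\times\mathrm{PC}:\|z\|\le\alpha,\ \|w\|_\infty\le\alpha\}$. Write $x_\tau(\xi)=x(\tau+\xi)$ for $\xi\in[-h,0]$. Let $f\colon[t_0,\vartheta]\times\mathbb R^n\times\mathbb R^n\times\mathbb U\to\mathbb R^n$ and $f^0\colon[t_0,\vartheta]\times\mathbb R^n\times\mathbb R^n\times\mathbb U\to\mathbb R$ be continuous, and let $\sigma\colon\mathbb R^n\times\mathrm{PC}\to\mathbb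 R$. Assume: * for every $\alpha>0$ there is $\lambda_f>0$ with $\|f(t,x,y,u)-f(t,x',y',u)\|+|f^0(t,x,y,u)-f^0(t,x',y',u)|\le\lambda_f(\|x-x'\|+\|y-y'\|)$ whenever $t\in[t_0,\vartheta]$, $u\in\mathbb U$ and $\|x\|,\|y\|,\|x'\|,\|y'\|\le\alpha$; * there is $c_f>0$ with $\|f(t,x,y,u)\|+|f^0(t,x,y,u)|\le c_f(1+\|x\|+\|y\|)$ for all $t\in[t_0,\vartheta]$, $x,y\in\mathbb R^n$, $u\in\mathbb U$; * for every $\alpha>0$ there is $\lambda_\sigma>0$ with $|\sigma(z,w)-\sigma(z',w')|\le\lambda_\sigma(\|z-z'\|+\|w-w'\|_1)$ for all $(z,w),(z',w')\in P(\alpha)$. For $(t,z,w)\in\mathbb G$ let $\Lambda(t,z,w)$ be the set of $x\in\mathrm{PC}([t-h,\vartheta],\mathbb R^n)$ with $x(\tau)=w(\tau-t)$ for $\tau\in[t-h,t)$, $x(t)=z$, and $x$ Lipschitz continuous on $[t,\vartheta]$. For a measurable control $u\colon[t,\vartheta]\to\mathbb U$, the motion is the unique $x\in\Lambda(t,z,w)$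 with $\dot x(\tau)=f(\tau,x(\tau),x(\tau-h),u(\tau))$ for a.e. $\tau\in[t,\vartheta]$. The value functional is $$\rho(t,z,w)=\inf_{u}\Big(\sigma(x(\vartheta),x_\vartheta)+\int_t^\vartheta f^0(\xi,x(\xi),x(\xi-h),u(\xi))\,d\xi\Big),$$ where the infimum is over all measurable $u\colon[t,\vartheta]\to\mathbb U$ and $x$ is the corresponding motion. A functional $\varphi\colon\mathbb G\to\mathbb R$ is called ci-differentiable at $(t,z,w)\in\mathbb G$, $t<\vartheta$, with derivatives $\partial^{ci}_{t,w}\varphi(t,z,w)\in\mathbb R$ and $\nabla_z\varphi(t,z,w)\in\mathbb R^n$, if for every $x\in\Lambda(t,z,w)$ $$\varphi(\tau,v,x_\tau)-\varphi(t,z,w)=\partial^{ci}_{t,w}\varphi(t,z,w)(\tau-t)+\langle v-z,\nabla_z\varphi(t,z,w)\rangle+o(|\tau-t|+\|v-z\|),$$ for $\tau\in[t,\vartheta]$, $v\in\mathbb R^n$, where the $o$-term may depend on $t,z,x$ but is uniform in $(\tau,v)$. Let $H(t,x,y,s)=\min_{u\in\mathbb U}\big(\langle f(t,x,y,u),s\rangle+f^0(t,x,y,u)\big)$.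 The functional $\varphi$ satisfies the Hamilton-Jacobi-Bellman (HJB) equation at $(t,z,w)$ if $$\partial^{ci}_{t,w}\varphi(t,z,w)+H\big(t,z,w(-h),\nabla_z\varphi(t,z,w)\big)=0 .$$ Let $\Phi$ be the set of $\varphi\colon\mathbb G\to\mathbb R$ that are continuous in $t$ for fixed $(z,w)$ and such that for every $\alpha>0$ there is $\lambda_\varphi>0$ with $|\varphi(t,z,w)-\varphi(t,z',w')|\le\lambda_\varphi(\|z-z'\|+\|w-w'\|_1)$ for all $t\in[t_0,\vartheta]$ and $(z,w),(z',w')\in P(\alpha)$. Then: 1. If $\varphi\in\Phi$ is ci-differentiable at every $(t,z,w)\in\mathbb G$ with $t<\vartheta$, satisfies the HJB equation at all these points, and satisfies the terminal condition $\varphi(\vartheta,z,w)=\sigma(z,w)$ for all $(z,w)\in\mathbb R^n\times\mathrm{PC}$, then $\varphi=\rho$ on $\mathbb G$. 2. If $\rho$ is ci-differentiable at a point $(t,z,w)\in\mathbb G$ with $t<\vartheta$, then $\rho$ satisfies the HJB equation at this point. -/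

import Mathlib

open Set Filter Topology MeasureTheory

noncomputable section

namespace DelayHJB

/-- Piecewise continuity on `[a, b]`: there are `a = ξ 0 < ξ 1 < … < ξ k = b` such that `x` is
continuous on each `[ξ i, ξ (i+1))` and has a finite limit from the left at each `ξ (i+1)`.
Only the values of `x` on `[a, b]` matter; the value at `b` itself is arbitrary. -/
def IsPC {n : ℕ} (a b : ℝ) (x : ℝ → EuclideanSpace ℝ (Fin n)) : Prop :=
  ∃ (k : ℕ) (ξ : ℕ → ℝ), ξ 0 = a ∧ ξ k = b ∧ (∀ i < k, ξ i < ξ (i + 1)) ∧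
    ∀ i < k, ContinuousOn x (Ico (ξ i) (ξ (i + 1))) ∧
      ∃ l, Tendsto x (𝓝[<] (ξ (i + 1))) (𝓝 l)

/-- The segment `x_τ`, `x_τ(ξ) = x(τ + ξ)`, to be read on `[-h, 0]`. -/
def segment {n : ℕ} (x : ℝ → EuclideanSpace ℝ (Fin n)) (τ : ℝ) :
    ℝ → EuclideanSpace ℝ (Fin n) :=
  fun ξ => x (τ + ξ)

/-- The norm `‖w‖₁ = ∫_{-h}^0 ‖w(ξ)‖ dξ`. -/
def norm₁ {n : ℕ} (h : ℝ) (w : ℝ → EuclideanSpace ℝ (Fin n)) : ℝ :=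
  ∫ ξ in (-h)..0, ‖w ξ‖

/-- The set `P(α)` of pairs `(z, w)` with `w` piecewise continuous on `[-h, 0]`, `‖z‖ ≤ α` and
`‖w‖_∞ ≤ α`. -/
def P {n : ℕ} (h α : ℝ) :
    Set (EuclideanSpace ℝ (Fin n) × (ℝ → EuclideanSpace ℝ (Fin n))) :=
  {p | ‖p.1‖ ≤ α ∧ IsPC (-h) 0 p.2 ∧ ∀ ξ ∈ Icc (-h) 0, ‖p.2 ξ‖ ≤ α}

/-- The data of the optimal control problem with state space `ℝⁿ` and controls in `U ⊆ ℝᵐ`.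

Elements of `PC([-h, 0], ℝⁿ)` are represented by functions on `ℝ` that are piecewise continuous on
`[-h, 0]`. The Lipschitz conditions in `‖·‖₁` imposed below on `σ` and on the class `Φ` imply that
the values outside `[-h, 0]` have no influence on any functional that occurs. Likewise only the
values of `f`, `f₀` for `t ∈ [t₀, θ]` and `u ∈ U` matter. -/
structure Problem (n m : ℕ) where
  /-- initial time -/
  t₀ : ℝ
  /-- terminal time -/
  θ : ℝ
  /-- the delay -/
  h : ℝ
  /-- the set of control values -/
  U : Set (EuclideanSpace ℝ (Fin m))
  /-- the right-hand side of the delay equation -/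
  f : ℝ → EuclideanSpace ℝ (Fin n) → EuclideanSpace ℝ (Fin n) → EuclideanSpace ℝ (Fin m) →
    EuclideanSpace ℝ (Fin n)
  /-- the running cost -/
  f₀ : ℝ → EuclideanSpace ℝ (Fin n) → EuclideanSpace ℝ (Fin n) → EuclideanSpace ℝ (Fin m) → ℝ
  /-- the terminal cost -/
  σ : EuclideanSpace ℝ (Fin n) → (ℝ → EuclideanSpace ℝ (Fin n)) → ℝ

namespace Problem

variable {n m : ℕ} (Q : Problem n m)

/-- The standing assumptions on the data. -/
structure Standing : Prop where
  time_lt : Q.t₀ < Q.θ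
  delay_pos : 0 < Q.h
  compact : IsCompact Q.U
  nonempty : Q.U.Nonempty
  /-- `f` is continuous on `[t₀, θ] × ℝⁿ × ℝⁿ × U` -/
  cont_f : ContinuousOn
    (fun p : ℝ × EuclideanSpace ℝ (Fin n) × EuclideanSpace ℝ (Fin n) × EuclideanSpace ℝ (Fin m) =>
      Q.f p.1 p.2.1 p.2.2.1 p.2.2.2)
    (Icc Q.t₀ Q.θ ×ˢ univ ×ˢ univ ×ˢ Q.U)
  /-- `f₀` is continuous on `[t₀, θ] × ℝⁿ × ℝⁿ × U` -/
  cont_f₀ : ContinuousOn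
    (fun p : ℝ × EuclideanSpace ℝ (Fin n) × EuclideanSpace ℝ (Fin n) × EuclideanSpace ℝ (Fin m) =>
      Q.f₀ p.1 p.2.1 p.2.2.1 p.2.2.2)
    (Icc Q.t₀ Q.θ ×ˢ univ ×ˢ univ ×ˢ Q.U)
  /-- local Lipschitz continuity in the state and the delayed state -/
  lip : ∀ α > 0, ∃ L > 0, ∀ t ∈ Icc Q.t₀ Q.θ, ∀ x y x' y' : EuclideanSpace ℝ (Fin n),
    ‖x‖ ≤ α → ‖y‖ ≤ α → ‖x'‖ ≤ α → ‖y'‖ ≤ α → ∀ u ∈ Q.U,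
      ‖Q.f t x y u - Q.f t x' y' u‖ + |Q.f₀ t x y u - Q.f₀ t x' y' u| ≤
        L * (‖x - x'‖ + ‖y - y'‖)
  /-- linear growth -/
  growth : ∃ c > 0, ∀ t ∈ Icc Q.t₀ Q.θ, ∀ x y : EuclideanSpace ℝ (Fin n), ∀ u ∈ Q.U,
    ‖Q.f t x y u‖ + |Q.f₀ t x y u| ≤ c * (1 + ‖x‖ + ‖y‖)
  /-- local Lipschitz continuity of the terminal cost -/
  lip_σ : ∀ α > 0, ∃ L > 0, ∀ z w z' w', (z, w) ∈ P Q.h α → (z', w') ∈ P Q.h α →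
    |Q.σ z w - Q.σ z' w'| ≤ L * (‖z - z'‖ + norm₁ Q.h (w - w'))

/-- `(t, z, w) ∈ 𝔾 = [t₀, θ] × ℝⁿ × PC`. -/
def InG (t : ℝ) (_z : EuclideanSpace ℝ (Fin n)) (w : ℝ → EuclideanSpace ℝ (Fin n)) : Prop :=
  t ∈ Icc Q.t₀ Q.θ ∧ IsPC (-Q.h) 0 w

/-- The set `Λ(t, z, w)` of piecewise continuous `x` on `[t - h, θ]` that continue `w` by a
Lipschitz function on `[t, θ]` starting at `z`. -/
def Lam (t : ℝ) (z : EuclideanSpace ℝ (Fin n)) (w : ℝ → EuclideanSpace ℝ (Fin n)) :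
    Set (ℝ → EuclideanSpace ℝ (Fin n)) :=
  {x | IsPC (t - Q.h) Q.θ x ∧ (∀ τ ∈ Ico (t - Q.h) t, x τ = w (τ - t)) ∧
    (∃ K, LipschitzOnWith K x (Icc t Q.θ)) ∧ x t = z}

/-- The set `𝔘(t)` of (Lebesgue) measurable controls `u : [t, θ] → U`. -/
def Controls (t : ℝ) : Set (ℝ → EuclideanSpace ℝ (Fin m)) :=
  {u | AEMeasurable u (volume.restrict (Icc t Q.θ)) ∧ ∀ τ ∈ Icc t Q.θ, u τ ∈ Q.U}

/-- `x` is a motion from `(t, z, w)` under the control `u`. -/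
def IsMotion (t : ℝ) (z : EuclideanSpace ℝ (Fin n)) (w : ℝ → EuclideanSpace ℝ (Fin n))
    (u : ℝ → EuclideanSpace ℝ (Fin m)) (x : ℝ → EuclideanSpace ℝ (Fin n)) : Prop :=
  x ∈ Q.Lam t z w ∧
    ∀ᵐ τ ∂(volume.restrict (Icc t Q.θ)), HasDerivAt x (Q.f τ (x τ) (x (τ - Q.h)) (u τ)) τ

/-- The Bolza cost of the control `u` with motion `x` on `[t, θ]`. -/
def cost (t : ℝ) (u : ℝ → EuclideanSpace ℝ (Fin m)) (x : ℝ → EuclideanSpace ℝ (Fin n)) : ℝ :=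
  Q.σ (x Q.θ) (segment x Q.θ) + ∫ ξ in t..Q.θ, Q.f₀ ξ (x ξ) (x (ξ - Q.h)) (u ξ)

/-- The value functional `ρ`: the infimum over all controls of the cost along the motion. -/
def value (t : ℝ) (z : EuclideanSpace ℝ (Fin n)) (w : ℝ → EuclideanSpace ℝ (Fin n)) : ℝ :=
  sInf {r | ∃ u ∈ Q.Controls t, ∃ x, Q.IsMotion t z w u x ∧ r = Q.cost t u x}

/-- The Hamiltonian `H(t, x, y, s) = min_{u ∈ U} (⟨f(t,x,y,u), s⟩ + f₀(t,x,y,u))`. -/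
def H (t : ℝ) (x y s : EuclideanSpace ℝ (Fin n)) : ℝ :=
  sInf ((fun u => inner ℝ (Q.f t x y u) s + Q.f₀ t x y u) '' Q.U)

/-- `φ` is ci-differentiable at `(t, z, w)` with ci-derivative `p₀` with respect to `{t, w}` and
gradient `p` with respect to `z`: for every `x ∈ Λ(t, z, w)`, the first-order expansion holds with
error `o(|τ - t| + ‖v - z‖)` as `(τ, v) → (t, z)`, `τ ∈ [t, θ]`, `(τ, v) ≠ (t, z)`. -/
def HasCIDerivAt (φ : ℝ → EuclideanSpace ℝ (Fin n) → (ℝ → EuclideanSpace ℝ (Fin n)) → ℝ)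
    (t : ℝ) (z : EuclideanSpace ℝ (Fin n)) (w : ℝ → EuclideanSpace ℝ (Fin n))
    (p₀ : ℝ) (p : EuclideanSpace ℝ (Fin n)) : Prop :=
  ∀ x ∈ Q.Lam t z w,
    (fun q : ℝ × EuclideanSpace ℝ (Fin n) =>
      φ q.1 q.2 (segment x q.1) - φ t z w - (p₀ * (q.1 - t) + inner ℝ (q.2 - z) p))
    =o[𝓝[(Icc t Q.θ ×ˢ univ) \ {(t, z)}] (t, z)]
    (fun q : ℝ × EuclideanSpace ℝ (Fin n) => |q.1 - t| + ‖q.2 - z‖)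

/-- `φ` is ci-differentiable at `(t, z, w)`. -/
def CIDifferentiableAt
    (φ : ℝ → EuclideanSpace ℝ (Fin n) → (ℝ → EuclideanSpace ℝ (Fin n)) → ℝ)
    (t : ℝ) (z : EuclideanSpace ℝ (Fin n)) (w : ℝ → EuclideanSpace ℝ (Fin n)) : Prop :=
  ∃ p₀ p, Q.HasCIDerivAt φ t z w p₀ p

/-- The ci-derivatives of `φ` at `(t, z, w)` (unique where they exist, for `t < θ`) satisfy the
Hamilton-Jacobi-Bellman equation. -/
def SatisfiesHJBAt
    (φ : ℝ → EuclideanSpace ℝ (Fin n) → (ℝ → EuclideanSpace ℝ (Fin n)) → ℝ)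
    (t : ℝ) (z : EuclideanSpace ℝ (Fin n)) (w : ℝ → EuclideanSpace ℝ (Fin n)) : Prop :=
  ∀ p₀ p, Q.HasCIDerivAt φ t z w p₀ p → p₀ + Q.H t z (w (-Q.h)) p = 0

/-- The terminal condition. -/
def TerminalCondition
    (φ : ℝ → EuclideanSpace ℝ (Fin n) → (ℝ → EuclideanSpace ℝ (Fin n)) → ℝ) : Prop :=
  ∀ z w, Q.InG Q.θ z w → φ Q.θ z w = Q.σ z w

/-- The class `Φ`: functionals continuous in `t` and locally Lipschitz in `(z, w)` with respect to
`‖z‖ + ‖w‖₁`, uniformly in `t`. -/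
structure MemPhi
    (φ : ℝ → EuclideanSpace ℝ (Fin n) → (ℝ → EuclideanSpace ℝ (Fin n)) → ℝ) : Prop where
  cont : ∀ z w, IsPC (-Q.h) 0 w → ContinuousOn (fun t => φ t z w) (Icc Q.t₀ Q.θ)
  lip : ∀ α > 0, ∃ L > 0, ∀ t ∈ Icc Q.t₀ Q.θ, ∀ z w z' w',
    (z, w) ∈ P Q.h α → (z', w') ∈ P Q.h α →
      |φ t z w - φ t z' w'| ≤ L * (‖z - z'‖ + norm₁ Q.h (w - w'))

end Problem

end DelayHJB

end

/-!
The proof compares a functional with the cost along motions by differentiating along the motions, so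
that no regularity of the ci-derivatives in the position is needed.

*Motions.* A motion is a solution of a delay integral equation. Grönwall's inequality bounds motions
and makes them depend on the initial data in a Lipschitz way with respect to `‖z‖ + ‖w‖₁`, and
causally on the control (`exists_dependence`, `IsMotion.eqOn`); they exist by a weighted contraction
argument (`exists_isMotion`). Hence the value functional `ρ` is locally Lipschitz in `(z, w)`
(`isLocallyLipschitz_value`).

*Expansion.* Let `φ` be locally Lipschitz in `(z, w)` and ci-differentiable at `(t, z, w)` with
derivatives `p₀`, `p`. Along every motion from `(t, z, w)` the increment of `φ` plus running cost on
`[t, τ]` is `∫ (p₀ + ⟨f(t, z, w(-h), u), p⟩ + f₀(t, z, w(-h), u)) + o(τ - t)`, with an error that is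
uniform over the controls (`HasCIDerivAt.exists_uniform_expansion`). The integrand is at least
`p₀ + H`, with equality for a minimizing constant control.

*The HJB equation for `ρ`.* Applied to `φ = ρ`, the expansion turns the dynamic programming
inequality for a minimizing constant control into `p₀ + H ≥ 0`, and the existence of
`o(τ - t)`-optimal controls into `p₀ + H ≤ 0` (`value_satisfiesHJBAt`).

*Verification.* For a ci-smooth solution `φ`, the function `τ ↦ φ(τ, x(τ), x_τ) + ∫ f₀` is continuous
along every motion and its lower right Dini derivatives are nonnegative at every point, so it is
nondecreasing and `φ ≤ ρ` (`le_cost_of_HJB`). Conversely, from every position a minimizing constant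
control keeps the increase of this function below `ε (τ - t)` for a short time, which depends on the
position. Such steps are exhausted by a maximality principle for preorders in which sequences are
bounded (`exists_forall_rel_le_of_sequences_bounded`), applied to pairs of a time and a control; this
gives `ρ ≤ φ` (`exists_cost_le_of_HJB`).
-/

noncomputable section

namespace DelayHJB

/-! ### Piecewise continuous functions -/

section PiecewiseContinuous

variable {n : ℕ} {a b c d : ℝ} {x y : ℝ → EuclideanSpace ℝ (Fin n)}

theorem IsPC.refl (a : ℝ) (x : ℝ → EuclideanSpace ℝ (Fin n)) : IsPC a a x :=
  ⟨0, fun _ => a, rfl, rfl, by simp, by simp⟩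

theorem IsPC.snoc (hx : IsPC a b x) (hbc : b < c) (hc : ContinuousOn x (Ico b c))
    (hl : ∃ l, Tendsto x (𝓝[<] c) (𝓝 l)) : IsPC a c x := by
  obtain ⟨k, ξ, h0, hk, hlt, hp⟩ := hx
  refine ⟨k + 1, fun i => if i ≤ k then ξ i else c, by simp [h0], by simp, ?_, ?_⟩
  · intro i hi
    rcases Nat.lt_succ_iff_lt_or_eq.1 hi with hi | rfl
    · simpa [hi.le, Nat.succ_le_iff.2 hi] using hlt i hi
    · simpa [hk] using hbc
  · intro i hi
    rcases Nat.lt_succ_iff_lt_or_eq.1 hi with hi | rfl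
    · simpa [hi.le, Nat.succ_le_iff.2 hi] using hp i hi
    · simpa [hk] using ⟨hc, hl⟩

/-- Induction on the number of pieces, adding the last piece. -/
theorem IsPC.induction {motive : ℝ → Prop} (hx : IsPC a b x) (refl : motive a)
    (snoc : ∀ b c, IsPC a b x → b < c → ContinuousOn x (Ico b c) →
      (∃ l, Tendsto x (𝓝[<] c) (𝓝 l)) → motive b → motive c) : motive b := by
  obtain ⟨k, ξ, h0, hk, hlt, hp⟩ := hx
  induction k generalizing b with
  | zero => rw [← hk, h0]; exact refl
  | succ k ih =>
    have h1 : IsPC a (ξ k) x :=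
      ⟨k, ξ, h0, rfl, fun i hi => hlt i (hi.trans k.lt_succ_self),
        fun i hi => hp i (hi.trans k.lt_succ_self)⟩
    subst hk
    exact snoc _ _ h1 (hlt k k.lt_succ_self) (hp k k.lt_succ_self).1 (hp k k.lt_succ_self).2
      (ih rfl (fun i hi => hlt i (hi.trans k.lt_succ_self))
        fun i hi => hp i (hi.trans k.lt_succ_self))

theorem IsPC.le (hx : IsPC a b x) : a ≤ b :=
  hx.induction le_rfl fun _ _ _ h _ _ hab => hab.trans h.le

theorem IsPC.append (hx : IsPC a b x) (hy : IsPC b c x) : IsPC a c x :=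
  hy.induction (motive := fun c => IsPC a c x) hx fun _ _ _ h hc hl hab => hab.snoc h hc hl

theorem IsPC.congr (hx : IsPC a b x) (hxy : EqOn x y (Ico a b)) : IsPC a b y := by
  revert hxy
  refine hx.induction (motive := fun b => EqOn x y (Ico a b) → IsPC a b y)
    (fun _ => IsPC.refl _ _) ?_
  rintro b c h hbc hc ⟨l, hl⟩ ih hxy
  refine (ih (hxy.mono (Ico_subset_Ico_right hbc.le))).snoc hbc
    (hc.congr fun s hs => (hxy ⟨h.le.trans hs.1, hs.2⟩).symm) ⟨l, hl.congr' ?_⟩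
  filter_upwards [Ico_mem_nhdsLT hbc] with s hs using hxy ⟨h.le.trans hs.1, hs.2⟩

theorem IsPC.of_continuousOn (hab : a ≤ b) (hx : ContinuousOn x (Icc a b)) : IsPC a b x := by
  rcases hab.eq_or_lt with rfl | hab
  · exact IsPC.refl _ _
  · refine (IsPC.refl a x).snoc hab (hx.mono Ico_subset_Icc_self) ⟨x b, ?_⟩
    have := (hx b (right_mem_Icc.2 hab.le)).mono (Ico_subset_Icc_self)
    rwa [ContinuousWithinAt, nhdsWithin_Ico_eq_nhdsLT hab] at this

theorem IsPC.shift (hx : IsPC a b x) (s : ℝ) : IsPC (a - s) (b - s) (fun ξ => x (s + ξ)) := by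
  refine hx.induction (motive := fun b => IsPC (a - s) (b - s) (fun ξ => x (s + ξ)))
    (IsPC.refl _ _) ?_
  intro b c _ hbc hc ⟨l, hl⟩ ih
  refine ih.snoc (by linarith) ?_ ⟨l, hl.comp ?_⟩
  · refine hc.comp (by fun_prop) fun ξ hξ => ?_
    simp only [mem_Ico] at hξ ⊢
    constructor <;> linarith
  · refine tendsto_nhdsWithin_iff.2 ⟨?_, ?_⟩
    · have : Tendsto (fun ξ => s + ξ) (𝓝 (c - s)) (𝓝 (s + (c - s))) :=
        (by fun_prop : Continuous fun ξ : ℝ => s + ξ).tendsto _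
      rw [add_sub_cancel] at this
      exact this.mono_left nhdsWithin_le_nhds
    · filter_upwards [self_mem_nhdsWithin] with ξ hξ
      simp only [mem_Iio] at hξ ⊢
      linarith

theorem IsPC.mono (hx : IsPC a b x) (hac : a ≤ c) (hcd : c ≤ d) (hdb : d ≤ b) : IsPC c d x := by
  revert d
  refine hx.induction (motive := fun b => ∀ {d}, c ≤ d → d ≤ b → IsPC c d x) ?_ ?_
  · intro d hcd hda
    obtain rfl : c = d := le_antisymm hcd (hda.trans hac)
    exact IsPC.refl _ _
  · intro b b' _ hbb hc hl ih d hcd hdb'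
    rcases le_or_gt d b with hdb | hbd
    · exact ih hcd hdb
    · have hlim : ∃ l, Tendsto x (𝓝[<] d) (𝓝 l) := by
        rcases hdb'.eq_or_lt with rfl | hdb'
        · exact hl
        · exact ⟨x d, ((hc d ⟨hbd.le, hdb'⟩).mono_of_mem_nhdsWithin
            (mem_nhdsWithin_of_mem_nhds (Ico_mem_nhds hbd hdb'))).tendsto⟩
      rcases le_or_gt c b with hcb | hbc
      · exact (ih hcb le_rfl).snoc hbd (hc.mono (Ico_subset_Ico_right hdb')) hlim
      · rcases hcd.eq_or_lt with rfl | hcd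
        · exact IsPC.refl _ _
        · exact (IsPC.refl c x).snoc hcd (hc.mono (Ico_subset_Ico hbc.le hdb')) hlim

theorem IsPC.bounded (hx : IsPC a b x) : ∃ C, ∀ s ∈ Icc a b, ‖x s‖ ≤ C := by
  refine hx.induction (motive := fun b => ∃ C, ∀ s ∈ Icc a b, ‖x s‖ ≤ C)
    ⟨‖x a‖, fun s hs => by rw [le_antisymm hs.2 hs.1]⟩ ?_
  rintro b c _ hbc hc ⟨l, hl⟩ ⟨C, hC⟩
  have h1 : ∀ᶠ s in 𝓝[<] c, ‖x s‖ < ‖l‖ + 1 := hl.norm.eventually_lt_const (by linarith)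
  obtain ⟨m, hm, hm'⟩ := (mem_nhdsLT_iff_exists_Ioo_subset' hbc).1 h1
  obtain ⟨D, hD⟩ := isCompact_Icc.exists_bound_of_continuousOn
    (hc.mono (Icc_subset_Ico_right (mem_Iio.1 hm)))
  refine ⟨max (max C ‖x c‖) (max D (‖l‖ + 1)), fun s hs => ?_⟩
  rcases le_or_gt s b with h | h
  · exact (hC s ⟨hs.1, h⟩).trans (by simp)
  rcases hs.2.eq_or_lt with rfl | h'
  · simp
  rcases le_or_gt s m with h2 | h2
  · exact (hD s ⟨h.le, h2⟩).trans (by simp)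
  · exact (hm' ⟨h2, h'⟩).le.trans (by simp)

theorem IsPC.exists_finite_continuousAt (hx : IsPC a b x) :
    ∃ F : Set ℝ, F.Finite ∧ ∀ s ∈ Ioo a b, s ∉ F → ContinuousAt x s := by
  refine hx.induction (motive := fun b => ∃ F : Set ℝ, F.Finite ∧
    ∀ s ∈ Ioo a b, s ∉ F → ContinuousAt x s) ⟨∅, by simp, by simp⟩ ?_
  rintro b c _ hbc hc - ⟨F, hF, h⟩
  refine ⟨insert b F, hF.insert b, fun s hs hsF => ?_⟩
  simp only [mem_insert_iff, not_or] at hsF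
  rcases lt_or_gt_of_ne hsF.1 with h1 | h1
  · exact h s ⟨hs.1, h1⟩ hsF.2
  · exact hc.continuousAt (Ico_mem_nhds h1 hs.2)

theorem IsPC.ae_continuousAt (hx : IsPC a b x) : ∀ᵐ s, s ∈ Icc a b → ContinuousAt x s := by
  obtain ⟨F, hF, h⟩ := hx.exists_finite_continuousAt
  have : ∀ᵐ s : ℝ, s ∉ F ∪ {a, b} := (hF.union (by simp)).measure_zero volume |>
    measure_eq_zero_iff_ae_notMem.1
  filter_upwards [this] with s hs hab
  simp only [mem_union, mem_insert_iff, mem_singleton_iff, not_or] at hs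
  exact h s ⟨lt_of_le_of_ne hab.1 (Ne.symm hs.2.1), lt_of_le_of_ne hab.2 hs.2.2⟩ hs.1

theorem IsPC.continuousWithinAt (hx : IsPC a b x) {s : ℝ} (hs : s ∈ Ico a b) :
    ContinuousWithinAt x (Ici s) s := by
  revert hs
  refine hx.induction (motive := fun b => s ∈ Ico a b → ContinuousWithinAt x (Ici s) s)
    (by simp) ?_
  rintro b c _ hbc hc - ih hs
  rcases lt_or_ge s b with h | h
  · exact ih ⟨hs.1, h⟩
  · exact (hc s ⟨h, hs.2⟩).mono_of_mem_nhdsWithin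
      (mem_of_superset (Ico_mem_nhdsGE hs.2) (Ico_subset_Ico_left h))

theorem IsPC.aemeasurable (hx : IsPC a b x) : AEMeasurable x (volume.restrict (Icc a b)) := by
  rw [← restrict_Ico_eq_restrict_Icc]
  refine hx.induction (motive := fun b => AEMeasurable x (volume.restrict (Ico a b)))
    (by simp) ?_
  rintro b c h hbc hc - ih
  rw [← Ico_union_Ico_eq_Ico h.le hbc.le]
  exact aemeasurable_union_iff.2 ⟨ih, hc.aemeasurable measurableSet_Ico⟩

theorem IsPC.intervalIntegrable_norm_sub (hx : IsPC a b x) (hy : IsPC a b y) :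
    IntervalIntegrable (fun s => ‖x s - y s‖) volume a b := by
  obtain ⟨C, hC⟩ := hx.bounded
  obtain ⟨D, hD⟩ := hy.bounded
  rw [intervalIntegrable_iff_integrableOn_Icc_of_le hx.le]
  refine Integrable.of_bound
    (hx.aemeasurable.sub hy.aemeasurable).norm.aestronglyMeasurable (C + D) ?_
  filter_upwards [ae_restrict_mem measurableSet_Icc] with s hs
  rw [norm_norm]
  exact (norm_sub_le _ _).trans (add_le_add (hC s hs) (hD s hs))

end PiecewiseContinuous

/-! ### Tools from analysis -/

section Tools

variable {E : Type*} [NormedAddCommGroup E] [NormedSpace ℝ E] {a b : ℝ}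

/-- Grönwall's inequality in integral form. -/
theorem le_mul_exp_of_le_add_integral {v : ℝ → ℝ} {A B : ℝ} (hv : ContinuousOn v (Icc a b))
    (hB : 0 ≤ B) (h : ∀ τ ∈ Icc a b, v τ ≤ A + B * ∫ s in a..τ, v s) :
    ∀ τ ∈ Icc a b, v τ ≤ A * Real.exp (B * (τ - a)) := by
  intro τ hτ
  have hab : a ≤ b := hτ.1.trans hτ.2
  set V : ℝ → ℝ := IccExtend hab ((Icc a b).domRestrict v) with hV
  have hVc : Continuous V := (continuousOn_iff_continuous_domRestrict.1 hv).Icc_extend'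
  have hVv : ∀ s ∈ Icc a b, V s = v s := fun s hs => IccExtend_of_mem hab _ hs
  have hint : ∀ s ∈ Icc a b, ∫ r in a..s, v r = ∫ r in a..s, V r := fun s hs =>
    intervalIntegral.integral_congr fun r hr => by
      rw [uIcc_of_le hs.1] at hr
      exact (hVv r ⟨hr.1, hr.2.trans hs.2⟩).symm
  have hd : ∀ s, HasDerivAt (fun s => A + B * ∫ r in a..s, V r) (B * V s) s := fun s =>
    ((hVc.integral_hasStrictDerivAt a s).hasDerivAt.const_mul B).const_add A
  have key := le_gronwallBound_of_liminf_deriv_right_le (a := a) (b := b) (δ := A) (K := B) (ε := 0)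
    (f := fun s => A + B * ∫ r in a..s, V r) (f' := fun s => B * V s)
    (fun s _ => (hd s).continuousAt.continuousWithinAt)
    (fun s _ r hr => by
      have := (hd s).hasDerivWithinAt (s := Ici s) |>.liminf_right_slope_le hr
      simpa [slope_def_field, div_eq_inv_mul] using this)
    (by simp)
    (fun s hs => by
      have hs' := Ico_subset_Icc_self hs
      rw [add_zero]
      refine mul_le_mul_of_nonneg_left ?_ hB
      rw [hVv s hs', ← hint s hs']
      exact h s hs') τ hτ
  rw [gronwallBound_ε0] at key
  refine (h τ hτ).trans ?_
  rw [hint τ hτ]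
  exact key

/-- A Lipschitz function is the integral of its almost everywhere derivative. -/
theorem eq_add_integral_of_lipschitzOnWith {x g : ℝ → E} {K : NNReal} {M : ℝ} [CompleteSpace E]
    (hx : LipschitzOnWith K x (Icc a b)) (hg : IntervalIntegrable g volume a b)
    (hM : ∀ s ∈ Icc a b, ‖g s‖ ≤ M)
    (hd : ∀ᵐ s ∂(volume.restrict (Icc a b)), HasDerivAt x (g s) s) :
    ∀ τ ∈ Icc a b, x τ = x a + ∫ s in a..τ, g s := by
  intro τ hτ
  have hab : a ≤ b := hτ.1.trans hτ.2
  have hL : LipschitzOnWith (Real.toNNReal M) (fun τ => ∫ s in a..τ, g s) (Icc a b) := by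
    refine LipschitzOnWith.of_dist_le_mul fun r hr s hs => ?_
    have hi : ∀ q ∈ Icc a b, IntervalIntegrable g volume a q := fun q hq =>
      hg.mono_set (by rw [uIcc_of_le hab, uIcc_of_le hq.1]; exact Icc_subset_Icc_right hq.2)
    rw [dist_eq_norm, intervalIntegral.integral_interval_sub_left (hi r hr) (hi s hs),
      Real.dist_eq]
    refine intervalIntegral.norm_integral_le_of_norm_le_const fun q hq => ?_
    have : q ∈ Icc a b := by
      rw [uIoc_eq_union] at hq
      rcases hq with hq | hq
      · exact ⟨hs.1.trans hq.1.le, hq.2.trans hr.2⟩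
      · exact ⟨hr.1.trans hq.1.le, hq.2.trans hs.2⟩
    exact (hM q this).trans (Real.le_coe_toNNReal M)
  rw [← uIcc_of_le hab] at hx hL
  have hac := hx.absolutelyContinuousOnInterval.sub hL.absolutelyContinuousOnInterval
  rw [ae_restrict_iff' measurableSet_Icc] at hd
  obtain ⟨C, hC⟩ := hac.const_of_ae_hasDerivAt_zero (by
    filter_upwards [hd, hg.ae_hasDerivAt_integral] with s h1 h2 hs
    have := (h1 (uIcc_of_le hab ▸ hs)).sub (h2 hs a left_mem_uIcc)
    rwa [sub_self] at this)
  have h1 := hC a left_mem_uIcc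
  have h2 := hC τ (by rwa [uIcc_of_le hab])
  simp only [Pi.sub_apply, intervalIntegral.integral_same, sub_zero] at h1 h2
  rw [h1, ← h2, sub_add_cancel]

/-- The radial retraction onto the closed ball of radius `R` around the origin. -/
def radialRetraction (R : ℝ) (x : E) : E := (R / max R ‖x‖) • x

theorem radialRetraction_of_norm_le {R : ℝ} (hR : 0 < R) {x : E} (hx : ‖x‖ ≤ R) :
    radialRetraction R x = x := by
  rw [radialRetraction, max_eq_left hx, div_self hR.ne', one_smul]

theorem norm_radialRetraction_le {R : ℝ} (hR : 0 < R) (x : E) : ‖radialRetraction R x‖ ≤ R := by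
  have h : 0 < max R ‖x‖ := lt_max_of_lt_left hR
  rw [radialRetraction, norm_smul, Real.norm_of_nonneg (by positivity), div_mul_eq_mul_div,
    div_le_iff₀ h]
  exact mul_le_mul_of_nonneg_left (le_max_right _ _) hR.le

theorem norm_radialRetraction_le_norm {R : ℝ} (hR : 0 < R) (x : E) :
    ‖radialRetraction R x‖ ≤ ‖x‖ := by
  have h : 0 < max R ‖x‖ := lt_max_of_lt_left hR
  rw [radialRetraction, norm_smul, Real.norm_of_nonneg (by positivity)]
  exact mul_le_of_le_one_left (norm_nonneg _) ((div_le_one h).2 (le_max_left _ _))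

theorem norm_radialRetraction_sub_le {R : ℝ} (hR : 0 < R) (x y : E) :
    ‖radialRetraction R x - radialRetraction R y‖ ≤ 2 * ‖x - y‖ := by
  have hx : 0 < max R ‖x‖ := lt_max_of_lt_left hR
  have hy : 0 < max R ‖y‖ := lt_max_of_lt_left hR
  have h1 : radialRetraction R x - radialRetraction R y =
      (R / max R ‖x‖) • (x - y) + (R / max R ‖x‖ - R / max R ‖y‖) • y := by
    simp only [radialRetraction, smul_sub, sub_smul]; abel
  have h2 : |R / max R ‖x‖ - R / max R ‖y‖| * ‖y‖ ≤ ‖x - y‖ := by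
    have h3 : R / max R ‖x‖ - R / max R ‖y‖ =
        R / max R ‖x‖ * ((max R ‖y‖ - max R ‖x‖) / max R ‖y‖) := by
      field_simp
    have h4 : |max R ‖y‖ - max R ‖x‖| ≤ ‖x - y‖ := by
      refine (abs_max_sub_max_le_max R ‖y‖ R ‖x‖).trans ?_
      rw [sub_self, abs_zero, max_eq_right (abs_nonneg _), norm_sub_rev]
      exact abs_norm_sub_norm_le y x
    rw [h3, abs_mul, abs_of_pos (div_pos hR hx), abs_div, abs_of_pos hy]
    have h5 : R / max R ‖x‖ ≤ 1 := (div_le_one hx).2 (le_max_left _ _)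
    calc R / max R ‖x‖ * (|max R ‖y‖ - max R ‖x‖| / max R ‖y‖) * ‖y‖
        ≤ 1 * (‖x - y‖ / max R ‖y‖) * max R ‖y‖ := by
          gcongr
          exact le_max_right _ _
      _ = ‖x - y‖ := by field_simp
  rw [h1]
  refine (norm_add_le _ _).trans ?_
  rw [norm_smul, norm_smul, Real.norm_eq_abs, Real.norm_eq_abs, abs_of_pos (div_pos hR hx)]
  have h5 : R / max R ‖x‖ * ‖x - y‖ ≤ ‖x - y‖ :=
    mul_le_of_le_one_left (norm_nonneg _) ((div_le_one hx).2 (le_max_left _ _))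
  linarith

theorem continuous_radialRetraction {R : ℝ} (hR : 0 < R) :
    Continuous (radialRetraction R : E → E) :=
  (LipschitzWith.of_dist_le_mul (K := 2) fun x y => by
    simpa [dist_eq_norm] using norm_radialRetraction_sub_le hR x y).continuous

/-- A maximality principle: if `τ` is monotone and bounded along a preorder `r` in which increasing
sequences have upper bounds, then above every element there is one at which `τ` is maximal. In
contrast to Zorn's lemma only sequences have to be bounded. -/
theorem exists_forall_rel_le_of_sequences_bounded {S : Type*} (r : S → S → Prop) (τ : S → ℝ)
    {θ : ℝ} (refl : ∀ p, r p p) (trans : ∀ p q s, r p q → r q s → r p s)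
    (mono : ∀ p q, r p q → τ p ≤ τ q) (bdd : ∀ p, τ p ≤ θ)
    (seq : ∀ p : ℕ → S, (∀ k l, k ≤ l → r (p k) (p l)) → ∃ q, ∀ k, r (p k) q) (p₀ : S) :
    ∃ q, r p₀ q ∧ ∀ s, r q s → τ s ≤ τ q := by
  let g : S → ℝ := fun p => sSup (τ '' {q | r p q})
  have hbdd : ∀ p, BddAbove (τ '' {q | r p q}) := fun p => ⟨θ, by rintro _ ⟨q, -, rfl⟩; exact bdd q⟩
  have hg : ∀ p q, r p q → τ q ≤ g p := fun p q h => le_csSup (hbdd p) ⟨q, h, rfl⟩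
  have hstep : ∀ p, ∃ q, r p q ∧ (τ p + g p) / 2 ≤ τ q := by
    intro p
    rcases (hg p p (refl p)).eq_or_lt with h | h
    · exact ⟨p, refl p, by linarith⟩
    · obtain ⟨_, ⟨q, hq, rfl⟩, hlt⟩ := exists_lt_of_lt_csSup (s := τ '' {q | r p q})
        ⟨_, p, refl p, rfl⟩ (show (τ p + g p) / 2 < g p by linarith)
      exact ⟨q, hq, hlt.le⟩
  choose next hnext hnext' using hstep
  let p : ℕ → S := fun k => next^[k] p₀
  have hp : ∀ k, p (k + 1) = next (p k) := fun k => Function.iterate_succ_apply' _ _ _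
  have hmono : ∀ k l, k ≤ l → r (p k) (p l) := by
    intro k l hkl
    induction l, hkl using Nat.le_induction with
    | base => exact refl _
    | succ l _ ih => exact trans _ _ _ ih (hp l ▸ hnext (p l))
  obtain ⟨q, hq⟩ := seq p hmono
  refine ⟨q, hq 0, fun s hs => ?_⟩
  have hlim : ∃ T, Tendsto (fun k => τ (p k)) atTop (𝓝 T) :=
    ⟨_, tendsto_atTop_ciSup (fun k l h => mono _ _ (hmono k l h))
      ⟨θ, by rintro _ ⟨k, rfl⟩; exact bdd _⟩⟩
  obtain ⟨T, hT⟩ := hlim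
  have hT' : Tendsto (fun k => 2 * τ (p (k + 1)) - τ (p k)) atTop (𝓝 (2 * T - T)) :=
    ((hT.comp (tendsto_add_atTop_nat 1)).const_mul 2).sub hT
  have h1 : τ s ≤ 2 * T - T := ge_of_tendsto' hT' fun k => by
    have h2 := hg (p k) s (trans _ _ _ (hq k) hs)
    have h3 := hnext' (p k)
    rw [← hp] at h3
    linarith
  have h2 : T ≤ τ q := le_of_tendsto' hT fun k => mono _ _ (hq k)
  linarith

end Tools

/-! ### Delay integral inequalities and equations -/

section DelayIntegral

variable {n : ℕ} {t θ h : ℝ}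

theorem _root_.IntervalIntegrable.mono_Icc {G : Type*} [NormedAddCommGroup G] {g : ℝ → G}
    {a b c d : ℝ}
    (hg : IntervalIntegrable g volume a b) (hac : a ≤ c) (hcd : c ≤ d) (hdb : d ≤ b) :
    IntervalIntegrable g volume c d :=
  hg.mono_set (by
    rw [uIcc_of_le hcd, uIcc_of_le (hac.trans (hcd.trans hdb))]
    exact Icc_subset_Icc hac hdb)

theorem integral_delayed_le {p : ℝ → ℝ} (h0 : 0 ≤ h) (hp : IntervalIntegrable p volume (t - h) θ)
    (hpos : ∀ s, 0 ≤ p s) {τ : ℝ} (hτ : τ ∈ Icc t θ) :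
    ∫ s in t..τ, p (s - h) ≤ (∫ s in (t - h)..t, p s) + ∫ s in t..τ, p s := by
  rw [intervalIntegral.integral_comp_sub_right (fun s => p s),
    intervalIntegral.integral_add_adjacent_intervals
      (hp.mono_Icc le_rfl (by linarith) (hτ.1.trans hτ.2))
      (hp.mono_Icc (by linarith) hτ.1 hτ.2)]
  refine intervalIntegral.integral_mono_interval le_rfl (by linarith [hτ.1]) (by linarith)
    (Eventually.of_forall hpos) (hp.mono_Icc le_rfl (by linarith [hτ.1]) hτ.2)

theorem _root_.IntervalIntegrable.delayed {p : ℝ → ℝ} (h0 : 0 ≤ h)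
    (hp : IntervalIntegrable p volume (t - h) θ)
    {τ : ℝ} (hτ : τ ∈ Icc t θ) : IntervalIntegrable (fun s => p (s - h)) volume t τ := by
  have := (hp.mono_Icc le_rfl (show t - h ≤ τ - h by linarith [hτ.1])
    (by linarith [hτ.2])).comp_sub_right h
  simpa using this

/-- Grönwall's inequality for an integral inequality with a delay. -/
theorem le_mul_exp_of_le_add_integral_delayed {p : ℝ → ℝ} {A B τ₁ : ℝ} (h0 : 0 ≤ h)
    (hp : IntervalIntegrable p volume (t - h) θ) (hc : ContinuousOn p (Icc t θ))
    (hpos : ∀ s, 0 ≤ p s) (hB : 0 ≤ B) (hτ₁ : τ₁ ≤ θ)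
    (hle : ∀ τ ∈ Icc t τ₁, p τ ≤ A + B * ∫ s in t..τ, (p s + p (s - h))) :
    ∀ τ ∈ Icc t τ₁, p τ ≤ (A + B * ∫ s in (t - h)..t, p s) * Real.exp (2 * B * (τ - t)) := by
  refine le_mul_exp_of_le_add_integral (hc.mono (Icc_subset_Icc_right hτ₁)) (by positivity) ?_
  intro τ hτ
  have hτ' : τ ∈ Icc t θ := ⟨hτ.1, hτ.2.trans hτ₁⟩
  refine (hle τ hτ).trans ?_
  rw [intervalIntegral.integral_add (hp.mono_Icc (by linarith) hτ.1 hτ'.2) (hp.delayed h0 hτ')]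
  have := mul_le_mul_of_nonneg_left (integral_delayed_le h0 hp hpos hτ') hB
  linarith

/-- A priori bound for solutions of delay integral equations of linear growth. -/
theorem norm_le_of_linear_growth {x g : ℝ → EuclideanSpace ℝ (Fin n)} {α c : ℝ} (h0 : 0 ≤ h)
    (hc0 : 0 ≤ c) (hx : IsPC (t - h) θ x) (hxc : ContinuousOn x (Icc t θ))
    (hα : ∀ s ∈ Icc (t - h) t, ‖x s‖ ≤ α)
    (hg : ∀ s ∈ Icc t θ, ‖g s‖ ≤ c * (1 + ‖x s‖ + ‖x (s - h)‖))
    (hxg : ∀ τ ∈ Icc t θ, x τ = x t + ∫ s in t..τ, g s) :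
    ∀ τ ∈ Icc t θ, ‖x τ‖ ≤ (α + c * (θ - t) + c * (h * α)) * Real.exp (2 * c * (θ - t)) := by
  intro τ hτ
  have htθ := hτ.1.trans hτ.2
  have hpi : IntervalIntegrable (fun s => ‖x s‖) volume (t - h) θ := by
    simpa using hx.intervalIntegrable_norm_sub (y := 0)
      (IsPC.of_continuousOn hx.le continuousOn_const)
  have hα0 : 0 ≤ α := (norm_nonneg _).trans (hα t ⟨by linarith, le_rfl⟩)
  have h1 := le_mul_exp_of_le_add_integral_delayed (A := α + c * (θ - t)) (B := c) (τ₁ := θ) h0 hpi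
    hxc.norm (fun s => norm_nonneg _) hc0 le_rfl (by
      intro τ hτ
      have hpτ := hpi.mono_Icc (show t - h ≤ t by linarith) hτ.1 hτ.2
      have hdτ := hpi.delayed h0 hτ
      have hsum := hpτ.add hdτ
      rw [hxg τ hτ]
      refine (norm_add_le _ _).trans ?_
      have h2 : ‖∫ s in t..τ, g s‖ ≤ ∫ s in t..τ, (c + c * (‖x s‖ + ‖x (s - h)‖)) := by
        refine intervalIntegral.norm_integral_le_of_norm_le hτ.1 (ae_of_all _ fun s hs => ?_)
          (intervalIntegrable_const.add (hsum.const_mul c))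
        refine (hg s ⟨hs.1.le, hs.2.trans hτ.2⟩).trans_eq (by ring)
      rw [intervalIntegral.integral_add intervalIntegrable_const (hsum.const_mul c),
        intervalIntegral.integral_const, intervalIntegral.integral_const_mul, smul_eq_mul] at h2
      have h3 := hα t ⟨by linarith, le_rfl⟩
      have h4 : (τ - t) * c ≤ c * (θ - t) := by nlinarith [hτ.2]
      linarith) τ hτ
  refine h1.trans ?_
  have h5 : ∫ s in (t - h)..t, ‖x s‖ ≤ h * α := by
    have := intervalIntegral.integral_mono_on (show t - h ≤ t by linarith)
      (hpi.mono_Icc le_rfl (by linarith) htθ) (intervalIntegrable_const (c := α)) hα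
    simpa using this
  have h6 : 0 ≤ h * α := by positivity
  have h7 : 0 ≤ θ - t := by linarith
  have h8 : τ - t ≤ θ - t := by linarith [hτ.2]
  gcongr

/-- Existence for delay integral equations with a bounded and globally Lipschitz right-hand side:
the Picard operator is a contraction of `C([t, θ], ℝⁿ)` for an exponentially weighted norm. -/
theorem exists_delay_integral_solution (F : ℝ → EuclideanSpace ℝ (Fin n) →
      EuclideanSpace ℝ (Fin n) → EuclideanSpace ℝ (Fin n)) {L M : ℝ} (hL : 0 < L) (h0 : 0 < h)
    (ht : t ≤ θ) (z : EuclideanSpace ℝ (Fin n)) {w : ℝ → EuclideanSpace ℝ (Fin n)}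
    (hw : IsPC (-h) 0 w)
    (hmeas : ∀ x, IsPC (t - h) θ x →
      AEStronglyMeasurable (fun s => F s (x s) (x (s - h))) (volume.restrict (Icc t θ)))
    (hM : ∀ s ∈ Icc t θ, ∀ a b, ‖F s a b‖ ≤ M)
    (hLip : ∀ s ∈ Icc t θ, ∀ a b a' b', ‖F s a b - F s a' b'‖ ≤ L * (‖a - a'‖ + ‖b - b'‖)) :
    ∃ x, IsPC (t - h) θ x ∧ (∀ τ ∈ Ico (t - h) t, x τ = w (τ - t)) ∧ ContinuousOn x (Icc t θ) ∧
      ∀ τ ∈ Icc t θ, x τ = z + ∫ s in t..τ, F s (x s) (x (s - h)) := by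
  -- The unknown is `y(s) = exp(-4L(s - t)) x(s)`: the sup norm of `y` is a weighted norm of `x`, in
  -- which the Picard operator has Lipschitz constant `2L / (4L)`.
  let lift : C(Icc t θ, EuclideanSpace ℝ (Fin n)) → ℝ → EuclideanSpace ℝ (Fin n) := fun y s =>
    if s < t then w (s - t) else Real.exp (4 * L * (s - t)) • y (projIcc t θ ht s)
  have hlift : ∀ y, ∀ s ∈ Icc t θ,
      lift y s = Real.exp (4 * L * (s - t)) • y (projIcc t θ ht s) := fun y s hs => by
    simp [lift, not_lt.2 hs.1]
  have hcont : ∀ y, ContinuousOn (lift y) (Icc t θ) := fun y =>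
    ContinuousOn.congr (by fun_prop) (hlift y)
  have hinit : ∀ y, ∀ s ∈ Ico (t - h) t, lift y s = w (s - t) := fun y s hs => by
    simp [lift, hs.2]
  have hpc : ∀ y, IsPC (t - h) θ (lift y) := by
    intro y
    refine IsPC.append (b := t) ?_ (IsPC.of_continuousOn ht (hcont y))
    have h1 := hw.shift (-t)
    rw [sub_neg_eq_add, sub_neg_eq_add, zero_add, neg_add_eq_sub] at h1
    exact h1.congr fun s hs => by rw [hinit y s hs, ← neg_add_eq_sub]
  have hint : ∀ y, IntervalIntegrable (fun s => F s (lift y s) (lift y (s - h))) volume t θ := by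
    intro y
    rw [intervalIntegrable_iff_integrableOn_Icc_of_le ht]
    refine Integrable.of_bound (hmeas _ (hpc y)) M ?_
    filter_upwards [ae_restrict_mem measurableSet_Icc] with s hs using hM s hs _ _
  have hdiff : ∀ y y' s, ‖lift y s - lift y' s‖ ≤ Real.exp (4 * L * (s - t)) * dist y y' := by
    intro y y' s
    by_cases hs : s < t
    · simp only [lift, hs, if_true, sub_self, norm_zero]
      positivity
    · simp only [lift, hs, if_false]
      rw [← smul_sub, norm_smul, Real.norm_of_nonneg (Real.exp_pos _).le, ← dist_eq_norm]
      gcongr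
      exact ContinuousMap.dist_apply_le_dist _
  let T : C(Icc t θ, EuclideanSpace ℝ (Fin n)) → C(Icc t θ, EuclideanSpace ℝ (Fin n)) := fun y =>
    { toFun := fun s => Real.exp (-(4 * L * (s - t))) •
        (z + ∫ r in t..(s : ℝ), F r (lift y r) (lift y (r - h)))
      continuous_toFun := by
        have h1 := intervalIntegral.continuousOn_primitive_interval' (hint y) left_mem_uIcc
        rw [uIcc_of_le ht, continuousOn_iff_continuous_domRestrict] at h1
        have h2 : Continuous fun s : Icc t θ => ∫ r in t..(s : ℝ), F r (lift y r) (lift y (r - h)) :=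
          h1
        fun_prop }
  have hT : ContractingWith (1 / 2) T := by
    refine ⟨by rw [← NNReal.coe_lt_coe]; norm_num, LipschitzWith.of_dist_le_mul fun y y' => ?_⟩
    refine (ContinuousMap.dist_le (by positivity)).2 fun s => ?_
    have hs := s.2
    have hi : ∀ y, IntervalIntegrable (fun s => F s (lift y s) (lift y (s - h))) volume t s :=
      fun y => (hint y).mono_Icc le_rfl hs.1 hs.2
    change dist (Real.exp (-(4 * L * (s - t))) • (z + _)) (Real.exp (-(4 * L * (s - t))) • (z + _))
      ≤ _
    rw [dist_eq_norm, ← smul_sub, add_sub_add_left_eq_sub,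
      ← intervalIntegral.integral_sub (hi y) (hi y'), norm_smul,
      Real.norm_of_nonneg (Real.exp_pos _).le]
    set D := dist y y'
    have hD : 0 ≤ D := dist_nonneg
    have hder : ∀ r, HasDerivAt (fun r => D / 2 * Real.exp (4 * L * (r - t)))
        (2 * L * D * Real.exp (4 * L * (r - t))) r := fun r => by
      have := ((((hasDerivAt_id r).sub_const t).const_mul (4 * L)).exp).const_mul (D / 2)
      convert! this using 1
      simp only [id]; ring
    have hbd : ‖∫ r in t..(s : ℝ), (F r (lift y r) (lift y (r - h)) -
        F r (lift y' r) (lift y' (r - h)))‖ ≤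
        ∫ r in t..(s : ℝ), 2 * L * D * Real.exp (4 * L * (r - t)) := by
      refine intervalIntegral.norm_integral_le_of_norm_le hs.1 (ae_of_all _ fun r hr => ?_)
        (Continuous.intervalIntegrable (by fun_prop) _ _)
      refine (hLip r ⟨hr.1.le, hr.2.trans hs.2⟩ _ _ _ _).trans ?_
      have h1 := hdiff y y' r
      have h2 := hdiff y y' (r - h)
      have h3 : Real.exp (4 * L * (r - h - t)) ≤ Real.exp (4 * L * (r - t)) := by
        gcongr; linarith
      have h4 := mul_le_mul_of_nonneg_right h3 hD
      have h5 := mul_le_mul_of_nonneg_left (add_le_add h1 (h2.trans h4)) hL.le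
      exact h5.trans_eq (by ring)
    rw [intervalIntegral.integral_eq_sub_of_hasDerivAt (fun r _ => hder r)
      (Continuous.intervalIntegrable (by fun_prop) _ _), sub_self, mul_zero, Real.exp_zero] at hbd
    have h6 : Real.exp (-(4 * L * (s - t))) * Real.exp (4 * L * (s - t)) = 1 := by
      rw [← Real.exp_add, neg_add_cancel, Real.exp_zero]
    have h7 := mul_le_mul_of_nonneg_left hbd (Real.exp_pos (-(4 * L * (s - t)))).le
    have h8 := mul_nonneg (Real.exp_pos (-(4 * L * (s - t)))).le hD
    have h9 : ((1 / 2 : NNReal) : ℝ) = 1 / 2 := by norm_num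
    rw [h9]
    nlinarith
  obtain ⟨y, hy⟩ : ∃ y, T y = y := ⟨_, hT.fixedPoint_isFixedPt⟩
  refine ⟨lift y, hpc y, hinit y, hcont y, fun τ hτ => ?_⟩
  have h1 : y ⟨τ, hτ⟩ = Real.exp (-(4 * L * (τ - t))) •
      (z + ∫ r in t..τ, F r (lift y r) (lift y (r - h))) := by
    conv_lhs => rw [← hy]
    rfl
  rw [hlift y τ hτ, projIcc_of_mem ht hτ, h1, smul_smul, ← Real.exp_add, add_neg_cancel,
    Real.exp_zero, one_smul]

end DelayIntegral

namespace Problem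

/-! ### Motions of the control system -/

section Motions

variable {n m : ℕ} {Q : Problem n m} {t τ : ℝ} {z z' : EuclideanSpace ℝ (Fin n)}
  {w w' x x' : ℝ → EuclideanSpace ℝ (Fin n)} {u u' : ℝ → EuclideanSpace ℝ (Fin m)}

theorem _root_.DelayHJB.IsPC.aemeasurable_delayed {h θ : ℝ} (h0 : 0 ≤ h)
    (hx : IsPC (t - h) θ x) : AEMeasurable (fun s => x (s - h)) (volume.restrict (Icc t θ)) := by
  have h1 := (hx.shift (-h)).aemeasurable
  simp only [sub_neg_eq_add, sub_add_cancel, neg_add_eq_sub] at h1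
  exact h1.mono_measure (Measure.restrict_mono (Icc_subset_Icc_right (by linarith)) le_rfl)

/-- Measurability of a continuous function along a function with delay and a control. -/
theorem aestronglyMeasurable_along {G : Type*} [NormedAddCommGroup G] [MeasurableSpace G]
    [BorelSpace G] [SecondCountableTopology G]
    {F : ℝ → EuclideanSpace ℝ (Fin n) → EuclideanSpace ℝ (Fin n) → EuclideanSpace ℝ (Fin m) → G}
    (hQ : Q.Standing) (ht : t ∈ Icc Q.t₀ Q.θ)
    (hF : ContinuousOn (fun p : ℝ × EuclideanSpace ℝ (Fin n) × EuclideanSpace ℝ (Fin n) ×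
      EuclideanSpace ℝ (Fin m) => F p.1 p.2.1 p.2.2.1 p.2.2.2)
      (Icc Q.t₀ Q.θ ×ˢ univ ×ˢ univ ×ˢ Q.U))
    (hx : IsPC (t - Q.h) Q.θ x) (hu : u ∈ Q.Controls t) :
    AEStronglyMeasurable (fun s => F s (x s) (x (s - Q.h)) (u s))
      (volume.restrict (Icc t Q.θ)) := by
  classical
  have hS : MeasurableSet (Icc Q.t₀ Q.θ ×ˢ (univ : Set (EuclideanSpace ℝ (Fin n))) ×ˢ
      (univ : Set (EuclideanSpace ℝ (Fin n))) ×ˢ Q.U) :=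
    measurableSet_Icc.prod (MeasurableSet.univ.prod
      (MeasurableSet.univ.prod hQ.compact.measurableSet))
  have h1 := hF.measurable_piecewise (continuousOn_const (c := (0 : G))) hS
  have hx1 : AEMeasurable x (volume.restrict (Icc t Q.θ)) :=
    hx.aemeasurable.mono_measure
      (Measure.restrict_mono (Icc_subset_Icc_left (by linarith [hQ.delay_pos])) le_rfl)
  have h2 : AEMeasurable (fun s => (s, x s, x (s - Q.h), u s)) (volume.restrict (Icc t Q.θ)) :=
    aemeasurable_id.prodMk (hx1.prodMk ((hx.aemeasurable_delayed hQ.delay_pos.le).prodMk hu.1))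
  refine ((h1.comp_aemeasurable h2).congr ?_).aestronglyMeasurable
  filter_upwards [ae_restrict_mem measurableSet_Icc] with s hs
  exact piecewise_eq_of_mem _ _ _ ⟨⟨ht.1.trans hs.1, hs.2⟩, trivial, trivial, hu.2 s hs⟩

theorem exists_bound_along (hQ : Q.Standing) (ht : t ∈ Icc Q.t₀ Q.θ)
    (hx : IsPC (t - Q.h) Q.θ x) (hu : u ∈ Q.Controls t) :
    ∃ M, ∀ s ∈ Icc t Q.θ, ‖Q.f s (x s) (x (s - Q.h)) (u s)‖ +
      |Q.f₀ s (x s) (x (s - Q.h)) (u s)| ≤ M := by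
  obtain ⟨C, hC⟩ := hx.bounded
  obtain ⟨c, hc, hg⟩ := hQ.growth
  have h0 := hQ.delay_pos
  refine ⟨c * (1 + C + C), fun s hs => ?_⟩
  refine (hg s ⟨ht.1.trans hs.1, hs.2⟩ _ _ _ (hu.2 s hs)).trans ?_
  have h1 := hC s ⟨by linarith [hs.1], hs.2⟩
  have h2 := hC (s - Q.h) ⟨by linarith [hs.1], by linarith [hs.2]⟩
  gcongr

theorem intervalIntegrable_f (hQ : Q.Standing) (ht : t ∈ Icc Q.t₀ Q.θ)
    (hx : IsPC (t - Q.h) Q.θ x) (hu : u ∈ Q.Controls t) :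
    IntervalIntegrable (fun s => Q.f s (x s) (x (s - Q.h)) (u s)) volume t Q.θ := by
  obtain ⟨M, hM⟩ := exists_bound_along hQ ht hx hu
  rw [intervalIntegrable_iff_integrableOn_Icc_of_le ht.2]
  refine Integrable.of_bound (aestronglyMeasurable_along hQ ht hQ.cont_f hx hu) M ?_
  filter_upwards [ae_restrict_mem measurableSet_Icc] with s hs
  exact (le_add_of_nonneg_right (abs_nonneg _)).trans (hM s hs)

theorem intervalIntegrable_f₀ (hQ : Q.Standing) (ht : t ∈ Icc Q.t₀ Q.θ)
    (hx : IsPC (t - Q.h) Q.θ x) (hu : u ∈ Q.Controls t) :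
    IntervalIntegrable (fun s => Q.f₀ s (x s) (x (s - Q.h)) (u s)) volume t Q.θ := by
  obtain ⟨M, hM⟩ := exists_bound_along hQ ht hx hu
  rw [intervalIntegrable_iff_integrableOn_Icc_of_le ht.2]
  refine Integrable.of_bound (aestronglyMeasurable_along hQ ht hQ.cont_f₀ hx hu) M ?_
  filter_upwards [ae_restrict_mem measurableSet_Icc] with s hs
  exact (le_add_of_nonneg_left (norm_nonneg _)).trans (hM s hs)

theorem continuousOn_of_mem_Lam (hx : x ∈ Q.Lam t z w) : ContinuousOn x (Icc t Q.θ) := by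
  obtain ⟨K, hK⟩ := hx.2.2.1
  exact hK.continuousOn

/-- Motions solve the delay integral equation. -/
theorem IsMotion.eq_add_integral (hx : Q.IsMotion t z w u x) (hQ : Q.Standing)
    (ht : t ∈ Icc Q.t₀ Q.θ) (hu : u ∈ Q.Controls t) (hτ : τ ∈ Icc t Q.θ) :
    x τ = z + ∫ s in t..τ, Q.f s (x s) (x (s - Q.h)) (u s) := by
  obtain ⟨K, hK⟩ := hx.1.2.2.1
  obtain ⟨M, hM⟩ := exists_bound_along hQ ht hx.1.1 hu
  have := eq_add_integral_of_lipschitzOnWith hK (intervalIntegrable_f hQ ht hx.1.1 hu)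
    (fun s hs => (le_add_of_nonneg_right (abs_nonneg _)).trans (hM s hs)) hx.2 τ hτ
  rwa [hx.1.2.2.2] at this

/-- Bound for motions that start in `P(α)`, uniform in the initial time and the control; `c` is the
constant in the linear growth condition. -/
def motionBound (Q : Problem n m) (c α : ℝ) : ℝ :=
  (α + c * (Q.θ - Q.t₀) + c * (Q.h * α)) * Real.exp (2 * c * (Q.θ - Q.t₀))

theorem le_motionBound (hQ : Q.Standing) {c α : ℝ} (hc : 0 ≤ c) (hα : 0 ≤ α) :
    α ≤ Q.motionBound c α := by
  have h0 := hQ.delay_pos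
  have hT : 0 < Q.θ - Q.t₀ := sub_pos.2 hQ.time_lt
  have h1 : 1 ≤ Real.exp (2 * c * (Q.θ - Q.t₀)) := Real.one_le_exp (by positivity)
  have h2 : 0 ≤ c * (Q.θ - Q.t₀) + c * (Q.h * α) := by positivity
  have h3 : α ≤ α + c * (Q.θ - Q.t₀) + c * (Q.h * α) := by linarith
  exact h3.trans (le_mul_of_one_le_right (by linarith) h1)

theorem norm_le_motionBound (hQ : Q.Standing) (ht : t ∈ Icc Q.t₀ Q.θ) {c α : ℝ} (hc : 0 ≤ c)
    {g : ℝ → EuclideanSpace ℝ (Fin n)} (hzw : (z, w) ∈ P Q.h α)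
    (hx : IsPC (t - Q.h) Q.θ x) (hxw : ∀ s ∈ Ico (t - Q.h) t, x s = w (s - t))
    (hxc : ContinuousOn x (Icc t Q.θ))
    (hg : ∀ s ∈ Icc t Q.θ, ‖g s‖ ≤ c * (1 + ‖x s‖ + ‖x (s - Q.h)‖))
    (hxg : ∀ τ ∈ Icc t Q.θ, x τ = z + ∫ s in t..τ, g s) :
    ∀ τ ∈ Icc (t - Q.h) Q.θ, ‖x τ‖ ≤ Q.motionBound c α := by
  intro τ hτ
  have hα : 0 ≤ α := (norm_nonneg _).trans hzw.1
  have h0 := hQ.delay_pos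
  rcases lt_or_ge τ t with h | h
  · rw [hxw τ ⟨hτ.1, h⟩]
    exact (hzw.2.2 _ ⟨by linarith [hτ.1], by linarith⟩).trans (le_motionBound hQ hc hα)
  have hxt : x t = z := by simpa using hxg t ⟨le_rfl, ht.2⟩
  refine (norm_le_of_linear_growth (α := α) h0.le hc hx hxc (fun s hs => ?_) hg
    (by rwa [hxt]) τ ⟨h, hτ.2⟩).trans ?_
  · rcases hs.2.eq_or_lt with rfl | hs'
    · rw [hxt]; exact hzw.1
    · rw [hxw s ⟨hs.1, hs'⟩]
      exact hzw.2.2 _ ⟨by linarith [hs.1], by linarith⟩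
  · rw [motionBound]
    have h1 : Q.θ - t ≤ Q.θ - Q.t₀ := by linarith [ht.1]
    have h2 : 0 ≤ Q.θ - t := by linarith [ht.2]
    have h3 : 0 ≤ Q.h * α := by positivity
    have h4 : 0 ≤ c * (Q.θ - Q.t₀) := mul_nonneg hc (h2.trans h1)
    have h5 : 0 ≤ α + c * (Q.θ - Q.t₀) + c * (Q.h * α) := by positivity
    gcongr

theorem exists_mem_P (z : EuclideanSpace ℝ (Fin n)) {h : ℝ} (hw : IsPC (-h) 0 w) :
    ∃ α > 0, (z, w) ∈ P h α := by
  obtain ⟨C, hC⟩ := hw.bounded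
  exact ⟨max 1 (max ‖z‖ C), by positivity, by simp, hw, fun s hs => (hC s hs).trans (by simp)⟩

theorem P_mono {h α β : ℝ} (hαβ : α ≤ β) : (P h α : Set (EuclideanSpace ℝ (Fin n) × _)) ⊆ P h β :=
  fun _ hp => ⟨hp.1.trans hαβ, hp.2.1, fun s hs => (hp.2.2 s hs).trans hαβ⟩

/-- Motions that start in `P(α)` have a common bound and a common Lipschitz constant. -/
theorem exists_uniform_bounds (hQ : Q.Standing) {α : ℝ} (hα : 0 < α) : ∃ R K : ℝ, α ≤ R ∧ 0 < K ∧
    ∀ {t z w u x}, t ∈ Icc Q.t₀ Q.θ → (z, w) ∈ P Q.h α → u ∈ Q.Controls t →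
      Q.IsMotion t z w u x → (∀ τ ∈ Icc (t - Q.h) Q.θ, ‖x τ‖ ≤ R) ∧
        (∀ τ ∈ Icc t Q.θ, |Q.f₀ τ (x τ) (x (τ - Q.h)) (u τ)| ≤ K) ∧
        ∀ τ ∈ Icc t Q.θ, ‖x τ - z‖ ≤ K * (τ - t) := by
  obtain ⟨c, hc, hg⟩ := hQ.growth
  have h0 := hQ.delay_pos
  have hαR := le_motionBound hQ hc.le hα.le
  refine ⟨Q.motionBound c α, c * (1 + Q.motionBound c α + Q.motionBound c α), hαR,
    by have := hα.trans_le hαR; positivity, ?_⟩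
  intro t z w u x ht hzw hu hx
  have hb : ∀ τ ∈ Icc (t - Q.h) Q.θ, ‖x τ‖ ≤ Q.motionBound c α :=
    norm_le_motionBound hQ ht hc.le hzw hx.1.1 hx.1.2.1 (continuousOn_of_mem_Lam hx.1)
      (fun s hs => (le_add_of_nonneg_right (abs_nonneg _)).trans
        (hg s ⟨ht.1.trans hs.1, hs.2⟩ _ _ _ (hu.2 s hs)))
      (fun τ hτ => hx.eq_add_integral hQ ht hu hτ)
  have hfb : ∀ s ∈ Icc t Q.θ, ‖Q.f s (x s) (x (s - Q.h)) (u s)‖ +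
      |Q.f₀ s (x s) (x (s - Q.h)) (u s)| ≤
      c * (1 + Q.motionBound c α + Q.motionBound c α) := by
    intro s hs
    refine (hg s ⟨ht.1.trans hs.1, hs.2⟩ _ _ _ (hu.2 s hs)).trans ?_
    have h1 := hb s ⟨by linarith [hs.1], hs.2⟩
    have h2 := hb (s - Q.h) ⟨by linarith [hs.1], by linarith [hs.2]⟩
    gcongr
  refine ⟨hb, fun τ hτ => (le_add_of_nonneg_left (norm_nonneg _)).trans (hfb τ hτ), fun τ hτ => ?_⟩
  rw [hx.eq_add_integral hQ ht hu hτ, add_sub_cancel_left, ← abs_of_nonneg (sub_nonneg.2 hτ.1)]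
  refine intervalIntegral.norm_integral_le_of_norm_le_const fun s hs => ?_
  rw [uIoc_of_le hτ.1] at hs
  exact (le_add_of_nonneg_right (abs_nonneg _)).trans (hfb s ⟨hs.1.le, hs.2.trans hτ.2⟩)

/-- Every control has a motion. -/
theorem exists_isMotion (hQ : Q.Standing) (ht : t ∈ Icc Q.t₀ Q.θ) (z : EuclideanSpace ℝ (Fin n))
    (hw : IsPC (-Q.h) 0 w) (hu : u ∈ Q.Controls t) : ∃ x, Q.IsMotion t z w u x := by
  obtain ⟨α, hα, hzw⟩ := exists_mem_P z hw
  obtain ⟨c, hc, hg⟩ := hQ.growth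
  have h0 := hQ.delay_pos
  set R := Q.motionBound c α with hRdef
  have hR : 0 < R := hα.trans_le (le_motionBound hQ hc.le hα.le)
  obtain ⟨L, hL, hlip⟩ := hQ.lip R hR
  have hmem : ∀ s ∈ Icc t Q.θ, s ∈ Icc Q.t₀ Q.θ := fun s hs => ⟨ht.1.trans hs.1, hs.2⟩
  -- Motions stay in the ball of radius `R`, so truncating there makes `f` bounded and globally
  -- Lipschitz without affecting them.
  have hcF : ContinuousOn (fun p : ℝ × EuclideanSpace ℝ (Fin n) × EuclideanSpace ℝ (Fin n) ×
      EuclideanSpace ℝ (Fin m) =>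
      Q.f p.1 (radialRetraction R p.2.1) (radialRetraction R p.2.2.1) p.2.2.2)
      (Icc Q.t₀ Q.θ ×ˢ univ ×ˢ univ ×ˢ Q.U) := by
    have hcr : Continuous (radialRetraction R : EuclideanSpace ℝ (Fin n) → _) :=
      continuous_radialRetraction hR
    have hcont : Continuous (fun p : ℝ × EuclideanSpace ℝ (Fin n) × EuclideanSpace ℝ (Fin n) ×
        EuclideanSpace ℝ (Fin m) =>
        (p.1, radialRetraction R p.2.1, radialRetraction R p.2.2.1, p.2.2.2)) := by fun_prop
    exact hQ.cont_f.comp hcont.continuousOn fun p hp => ⟨hp.1, trivial, trivial, hp.2.2.2⟩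
  obtain ⟨x, hx, hxw, hxc, hxg⟩ := exists_delay_integral_solution (t := t) (θ := Q.θ) (h := Q.h)
    (fun s a b => Q.f s (radialRetraction R a) (radialRetraction R b) (u s))
    (L := L * 2) (M := c * (1 + R + R)) (by positivity) h0 ht.2 z hw
    (fun x hx => aestronglyMeasurable_along
      (F := fun s a b v => Q.f s (radialRetraction R a) (radialRetraction R b) v)
      hQ ht hcF hx hu)
    (fun s hs a b => by
      have := hg s (hmem s hs) (radialRetraction R a) (radialRetraction R b) _ (hu.2 s hs)
      refine ((le_add_of_nonneg_right (abs_nonneg _)).trans this).trans ?_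
      have h1 := norm_radialRetraction_le hR a
      have h2 := norm_radialRetraction_le hR b
      gcongr)
    (fun s hs a b a' b' => by
      have := hlip s (hmem s hs) (radialRetraction R a) (radialRetraction R b)
        (radialRetraction R a') (radialRetraction R b') (norm_radialRetraction_le hR _)
        (norm_radialRetraction_le hR _) (norm_radialRetraction_le hR _)
        (norm_radialRetraction_le hR _) _ (hu.2 s hs)
      refine ((le_add_of_nonneg_right (abs_nonneg _)).trans this).trans ?_
      have h1 := norm_radialRetraction_sub_le hR a a'
      have h2 := norm_radialRetraction_sub_le hR b b'
      exact (mul_le_mul_of_nonneg_left (add_le_add h1 h2) hL.le).trans_eq (by ring))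
  have hb : ∀ τ ∈ Icc (t - Q.h) Q.θ, ‖x τ‖ ≤ R := by
    refine norm_le_motionBound hQ ht hc.le hzw hx hxw hxc (fun s hs => ?_) hxg
    have := hg s (hmem s hs) (radialRetraction R (x s)) (radialRetraction R (x (s - Q.h))) _
      (hu.2 s hs)
    refine ((le_add_of_nonneg_right (abs_nonneg _)).trans this).trans ?_
    have h1 := norm_radialRetraction_le_norm hR (x s)
    have h2 := norm_radialRetraction_le_norm hR (x (s - Q.h))
    gcongr
  have hxf : ∀ τ ∈ Icc t Q.θ, x τ = z + ∫ s in t..τ, Q.f s (x s) (x (s - Q.h)) (u s) := by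
    intro τ hτ
    rw [hxg τ hτ]
    congr 1
    refine intervalIntegral.integral_congr fun s hs => ?_
    rw [uIcc_of_le hτ.1] at hs
    have h1 := hb s ⟨by linarith [hs.1], hs.2.trans hτ.2⟩
    have h2 := hb (s - Q.h) ⟨by linarith [hs.1], by linarith [hs.2, hτ.2]⟩
    simp only [radialRetraction_of_norm_le hR h1, radialRetraction_of_norm_le hR h2]
  have hint := intervalIntegrable_f hQ ht hx hu
  obtain ⟨M, hM⟩ := exists_bound_along hQ ht hx hu
  refine ⟨x, ⟨hx, hxw, ⟨Real.toNNReal M, LipschitzOnWith.of_dist_le_mul fun r hr s hs => ?_⟩, ?_⟩, ?_⟩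
  · rw [hxf r hr, hxf s hs, dist_add_left, dist_eq_norm,
      intervalIntegral.integral_interval_sub_left (hint.mono_Icc le_rfl hr.1 hr.2)
        (hint.mono_Icc le_rfl hs.1 hs.2), Real.dist_eq]
    refine intervalIntegral.norm_integral_le_of_norm_le_const fun q hq => ?_
    have : q ∈ Icc t Q.θ := by
      rw [uIoc_eq_union] at hq
      rcases hq with hq | hq
      · exact ⟨hs.1.trans hq.1.le, hq.2.trans hr.2⟩
      · exact ⟨hr.1.trans hq.1.le, hq.2.trans hs.2⟩
    exact ((le_add_of_nonneg_right (abs_nonneg _)).trans (hM q this)).trans (Real.le_coe_toNNReal M)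
  · simpa using hxf t ⟨le_rfl, ht.2⟩
  · rw [← restrict_Ioo_eq_restrict_Icc, ae_restrict_iff' measurableSet_Ioo]
    filter_upwards [hint.ae_hasDerivAt_integral] with s hs hsI
    rw [uIcc_of_le ht.2] at hs
    refine ((hs (Ioo_subset_Icc_self hsI) t (left_mem_Icc.2 ht.2)).const_add z).congr_of_eventuallyEq
      ?_
    filter_upwards [Icc_mem_nhds hsI.1 hsI.2] with r hr using hxf r hr

theorem norm₁_segment_eq {h : ℝ} (y : ℝ → EuclideanSpace ℝ (Fin n)) (τ : ℝ) :
    norm₁ h (segment y τ) = ∫ s in (τ - h)..τ, ‖y s‖ := by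
  have := intervalIntegral.integral_comp_add_left (a := -h) (b := 0) (fun s => ‖y s‖) τ
  rw [add_zero, ← sub_eq_add_neg] at this
  exact this

theorem norm₁_sub_eq_integral (hQ : Q.Standing) (hx : ∀ s ∈ Ico (t - Q.h) t, x s = w (s - t))
    (hx' : ∀ s ∈ Ico (t - Q.h) t, x' s = w' (s - t)) :
    norm₁ Q.h (w - w') = ∫ s in (t - Q.h)..t, ‖x s - x' s‖ := by
  have h1 := intervalIntegral.integral_comp_sub_right (a := t - Q.h) (b := t)
    (fun s => ‖w s - w' s‖) t
  rw [sub_self, sub_sub_cancel_left] at h1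
  change ∫ s in (-Q.h)..0, ‖w s - w' s‖ = _
  rw [← h1]
  refine intervalIntegral.integral_congr_ae ?_
  have h2 : ∀ᵐ s : ℝ, s ≠ t := by simp [ae_iff, measure_singleton]
  filter_upwards [h2] with s hs hI
  rw [uIoc_of_le (by linarith [hQ.delay_pos])] at hI
  have : s ∈ Ico (t - Q.h) t := ⟨hI.1.le, lt_of_le_of_ne hI.2 hs⟩
  rw [hx s this, hx' s this]

theorem norm₁_nonneg (hQ : Q.Standing) (w : ℝ → EuclideanSpace ℝ (Fin n)) : 0 ≤ norm₁ Q.h w :=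
  intervalIntegral.integral_nonneg (by linarith [hQ.delay_pos]) fun _ _ => norm_nonneg _

/-- Continuous dependence of motions on the initial data. It is causal: the controls have to agree
only before the time `τ₁` up to which the motions are compared. -/
theorem exists_dependence (hQ : Q.Standing) {α : ℝ} (hα : 0 < α) : ∃ C > 0,
    ∀ {t z w u x z' w' u' x' τ₁}, t ∈ Icc Q.t₀ Q.θ → (z, w) ∈ P Q.h α → (z', w') ∈ P Q.h α →
      u ∈ Q.Controls t → u' ∈ Q.Controls t → Q.IsMotion t z w u x → Q.IsMotion t z' w' u' x' →
      τ₁ ∈ Icc t Q.θ → EqOn u u' (Ico t τ₁) →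
      ∀ τ ∈ Icc t τ₁, ‖x τ - x' τ‖ ≤ C * (‖z - z'‖ + norm₁ Q.h (w - w')) := by
  have h0 := hQ.delay_pos
  obtain ⟨R, K, hαR, -, hRK⟩ := exists_uniform_bounds hQ hα
  obtain ⟨L, hL, hlip⟩ := hQ.lip R (hα.trans_le hαR)
  refine ⟨(1 + L) * Real.exp (2 * L * (Q.θ - Q.t₀)), by positivity, ?_⟩
  intro t z w u x z' w' u' x' τ₁ ht hzw hzw' hu hu' hx hx' hτ₁ huu τ hτ
  have hb := (hRK ht hzw hu hx).1
  have hb' := (hRK ht hzw' hu' hx').1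
  have hp := hx.1.1.intervalIntegrable_norm_sub hx'.1.1
  have h1 := le_mul_exp_of_le_add_integral_delayed (p := fun s => ‖x s - x' s‖)
    (A := ‖z - z'‖) (B := L) (τ₁ := τ₁) h0.le hp
    ((continuousOn_of_mem_Lam hx.1).sub (continuousOn_of_mem_Lam hx'.1)).norm
    (fun _ => norm_nonneg _) hL.le hτ₁.2 (by
      intro τ hτ
      have hτθ : τ ∈ Icc t Q.θ := ⟨hτ.1, hτ.2.trans hτ₁.2⟩
      have hi := (intervalIntegrable_f hQ ht hx.1.1 hu).mono_Icc le_rfl hτθ.1 hτθ.2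
      have hi' := (intervalIntegrable_f hQ ht hx'.1.1 hu').mono_Icc le_rfl hτθ.1 hτθ.2
      rw [hx.eq_add_integral hQ ht hu hτθ, hx'.eq_add_integral hQ ht hu' hτθ, add_sub_add_comm,
        ← intervalIntegral.integral_sub hi hi', ← intervalIntegral.integral_const_mul]
      refine (norm_add_le _ _).trans (add_le_add_right ?_ _)
      have h2 : ∀ᵐ s : ℝ, s ≠ τ := by simp [ae_iff, measure_singleton]
      refine intervalIntegral.norm_integral_le_of_norm_le hτ.1 ?_
        (((hp.mono_Icc (by linarith) hτθ.1 hτθ.2).add (hp.delayed h0.le hτθ)).const_mul L)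
      filter_upwards [h2] with s hsτ hs
      have hsI : s ∈ Icc t Q.θ := ⟨hs.1.le, hs.2.trans hτθ.2⟩
      rw [← huu ⟨hs.1.le, (lt_of_le_of_ne hs.2 hsτ).trans_le hτ.2⟩]
      have hs1 : s ∈ Icc (t - Q.h) Q.θ := ⟨by linarith [hsI.1], hsI.2⟩
      have hs2 : s - Q.h ∈ Icc (t - Q.h) Q.θ := ⟨by linarith [hsI.1], by linarith [hsI.2]⟩
      exact (le_add_of_nonneg_right (abs_nonneg _)).trans
        (hlip s ⟨ht.1.trans hsI.1, hsI.2⟩ _ _ _ _ (hb _ hs1) (hb _ hs2) (hb' _ hs1) (hb' _ hs2) _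
          (hu.2 s hsI))) τ hτ
  refine h1.trans ?_
  rw [← norm₁_sub_eq_integral hQ hx.1.2.1 hx'.1.2.1]
  have h3 := norm₁_nonneg hQ (w - w')
  have h4 : τ - t ≤ Q.θ - Q.t₀ := by linarith [hτ.2, hτ₁.2, ht.1]
  have h5 : ‖z - z'‖ + L * norm₁ Q.h (w - w') ≤
      (1 + L) * (‖z - z'‖ + norm₁ Q.h (w - w')) := by
    nlinarith [norm_nonneg (z - z'), mul_nonneg hL.le (norm_nonneg (z - z'))]
  calc _ ≤ ((1 + L) * (‖z - z'‖ + norm₁ Q.h (w - w'))) * Real.exp (2 * L * (Q.θ - Q.t₀)) := by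
        gcongr
    _ = _ := by ring

/-- Causality: motions agree as long as their controls do. -/
theorem IsMotion.eqOn (hx : Q.IsMotion t z w u x) (hx' : Q.IsMotion t z w u' x')
    (hQ : Q.Standing) (ht : t ∈ Icc Q.t₀ Q.θ) (hw : IsPC (-Q.h) 0 w) (hu : u ∈ Q.Controls t)
    (hu' : u' ∈ Q.Controls t) (hτ : τ ∈ Icc t Q.θ) (huu : EqOn u u' (Ico t τ)) :
    EqOn x x' (Icc (t - Q.h) τ) := by
  intro s hs
  rcases lt_or_ge s t with h | h
  · rw [hx.1.2.1 s ⟨hs.1, h⟩, hx'.1.2.1 s ⟨hs.1, h⟩]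
  obtain ⟨α, hα, hzw⟩ := exists_mem_P z hw
  obtain ⟨C, -, hC⟩ := exists_dependence hQ hα
  have := hC ht hzw hzw hu hu' hx hx' hτ huu s ⟨h, hs.2⟩
  have h1 : norm₁ Q.h (w - w) = 0 := by simp [norm₁]
  rw [sub_self, norm_zero, h1, add_zero, mul_zero] at this
  exact sub_eq_zero.1 (norm_le_zero_iff.1 this)

theorem mem_Controls_mono (hu : u ∈ Q.Controls t) (hτ : t ≤ τ) : u ∈ Q.Controls τ :=
  ⟨hu.1.mono_measure (Measure.restrict_mono (Icc_subset_Icc_left hτ) le_rfl),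
    fun s hs => hu.2 s ⟨hτ.trans hs.1, hs.2⟩⟩

theorem segment_isPC (hx : IsPC (t - Q.h) Q.θ x) (hQ : Q.Standing) (hτ : τ ∈ Icc t Q.θ) :
    IsPC (-Q.h) 0 (segment x τ) := by
  have := (hx.mono (show t - Q.h ≤ τ - Q.h by linarith [hτ.1]) (by linarith [hQ.delay_pos])
    hτ.2).shift τ
  rwa [sub_self, sub_sub_cancel_left] at this

theorem mem_Lam_restrict (hx : x ∈ Q.Lam t z w) (hQ : Q.Standing) (hτ : τ ∈ Icc t Q.θ) :
    x ∈ Q.Lam τ (x τ) (segment x τ) := by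
  obtain ⟨K, hK⟩ := hx.2.2.1
  exact ⟨hx.1.mono (by linarith [hτ.1]) (by linarith [hτ.2, hQ.delay_pos]) le_rfl,
    fun s _ => by simp [segment], ⟨K, hK.mono (Icc_subset_Icc_left hτ.1)⟩, rfl⟩

/-- A motion is also the motion from each of its intermediate positions. -/
theorem IsMotion.restrict (hx : Q.IsMotion t z w u x) (hQ : Q.Standing) (hτ : τ ∈ Icc t Q.θ) :
    Q.IsMotion τ (x τ) (segment x τ) u x :=
  ⟨mem_Lam_restrict hx.1 hQ hτ,
    ae_mono (Measure.restrict_mono (Icc_subset_Icc_left hτ.1) le_rfl) hx.2⟩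

end Motions

/-! ### The value functional -/

section Value

variable {n m : ℕ} {Q : Problem n m} {t τ : ℝ} {z z' : EuclideanSpace ℝ (Fin n)}
  {w w' x x' : ℝ → EuclideanSpace ℝ (Fin n)} {u u' : ℝ → EuclideanSpace ℝ (Fin m)}
  {φ : ℝ → EuclideanSpace ℝ (Fin n) → (ℝ → EuclideanSpace ℝ (Fin n)) → ℝ}

/-- Local Lipschitz continuity in `(z, w)` with respect to `‖z‖ + ‖w‖₁`, uniformly in time: the
part of membership in `Φ` that the value functional has under the standing assumptions. -/
def IsLocallyLipschitz (Q : Problem n m)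
    (φ : ℝ → EuclideanSpace ℝ (Fin n) → (ℝ → EuclideanSpace ℝ (Fin n)) → ℝ) : Prop :=
  ∀ α > 0, ∃ L > 0, ∀ t ∈ Icc Q.t₀ Q.θ, ∀ z w z' w',
    (z, w) ∈ P Q.h α → (z', w') ∈ P Q.h α →
      |φ t z w - φ t z' w'| ≤ L * (‖z - z'‖ + norm₁ Q.h (w - w'))

theorem norm₁_sub_eq_zero (hQ : Q.Standing) (hww : EqOn w w' (Ico (-Q.h) 0)) :
    norm₁ Q.h (w - w') = 0 := by
  have h1 : ∀ᵐ s : ℝ, s ≠ 0 := by simp [ae_iff, measure_singleton]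
  rw [norm₁, intervalIntegral.integral_congr_ae (g := fun _ => (0 : ℝ)),
    intervalIntegral.integral_zero]
  filter_upwards [h1] with s hs hI
  rw [uIoc_of_le (by linarith [hQ.delay_pos])] at hI
  simp [hww ⟨hI.1.le, lt_of_le_of_ne hI.2 hs⟩]

theorem IsLocallyLipschitz.congr (hφ : Q.IsLocallyLipschitz φ) (hQ : Q.Standing)
    (ht : t ∈ Icc Q.t₀ Q.θ) (hw : IsPC (-Q.h) 0 w) (hw' : IsPC (-Q.h) 0 w')
    (hww : EqOn w w' (Ico (-Q.h) 0)) : φ t z w = φ t z w' := by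
  obtain ⟨α, hα, h1⟩ := exists_mem_P z hw
  obtain ⟨β, hβ, h2⟩ := exists_mem_P z hw'
  obtain ⟨L, -, hL⟩ := hφ (max α β) (lt_max_of_lt_left hα)
  have := hL t ht z w z w' (P_mono (le_max_left _ _) h1) (P_mono (le_max_right _ _) h2)
  rw [sub_self, norm_zero, norm₁_sub_eq_zero hQ hww, add_zero, mul_zero] at this
  exact sub_eq_zero.1 (abs_nonpos_iff.1 this)

theorem segment_eqOn (hx : x ∈ Q.Lam t z w) : EqOn (segment x t) w (Ico (-Q.h) 0) := by
  intro s hs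
  rw [segment, hx.2.1 _ ⟨by linarith [hs.1], by linarith [hs.2]⟩, add_sub_cancel_left]

theorem norm₁_le {h C : ℝ} (hw : IsPC (-h) 0 w) (hC : ∀ s ∈ Icc (-h) 0, ‖w s‖ ≤ C) :
    norm₁ h w ≤ h * C := by
  have hi : IntervalIntegrable (fun s => ‖w s‖) volume (-h) 0 := by
    simpa using hw.intervalIntegrable_norm_sub (y := 0)
      (IsPC.of_continuousOn hw.le continuousOn_const)
  have := intervalIntegral.integral_mono_on hw.le hi (intervalIntegrable_const (c := C)) hC
  simpa [norm₁] using this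

theorem norm₁_segment_sub_le (hQ : Q.Standing) (hx : x ∈ Q.Lam t z w) (hx' : x' ∈ Q.Lam t z' w')
    (hτ : τ ∈ Icc t Q.θ) :
    norm₁ Q.h (segment x τ - segment x' τ) ≤
      norm₁ Q.h (w - w') + ∫ s in t..τ, ‖x s - x' s‖ := by
  have h0 := hQ.delay_pos
  have hp := hx.1.intervalIntegrable_norm_sub hx'.1
  rw [norm₁_sub_eq_integral hQ hx.2.1 hx'.2.1,
    intervalIntegral.integral_add_adjacent_intervals
      (hp.mono_Icc le_rfl (by linarith) (hτ.1.trans hτ.2)) (hp.mono_Icc (by linarith) hτ.1 hτ.2)]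
  have h1 : segment x τ - segment x' τ = segment (fun s => x s - x' s) τ := rfl
  rw [h1, norm₁_segment_eq]
  exact intervalIntegral.integral_mono_interval (by linarith [hτ.1]) (by linarith) le_rfl
    (Eventually.of_forall fun _ => norm_nonneg _)
    (hp.mono_Icc le_rfl (by linarith [hτ.1]) hτ.2)

theorem segment_mem_P (hx : IsPC (t - Q.h) Q.θ x) (hQ : Q.Standing) (hτ : τ ∈ Icc t Q.θ) {R : ℝ}
    (hR : ∀ s ∈ Icc (t - Q.h) Q.θ, ‖x s‖ ≤ R) : (x τ, segment x τ) ∈ P Q.h R := by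
  have h0 := hQ.delay_pos
  refine ⟨hR τ ⟨by linarith [hτ.1], hτ.2⟩, segment_isPC hx hQ hτ, fun s hs => hR _ ⟨?_, ?_⟩⟩
  · linarith [hs.1, hτ.1]
  · linarith [hs.2, hτ.2]

theorem const_mem_Controls {v : EuclideanSpace ℝ (Fin m)} (hv : v ∈ Q.U) (t : ℝ) :
    (fun _ => v) ∈ Q.Controls t :=
  ⟨aemeasurable_const, fun _ _ => hv⟩

open Classical in
theorem piecewise_mem_Controls (hu : u ∈ Q.Controls t) (hu' : u' ∈ Q.Controls τ) :
    (Iio τ).piecewise u u' ∈ Q.Controls t := by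
  refine ⟨?_, fun s hs => ?_⟩
  · rw [← indicator_add_compl_eq_piecewise]
    refine AEMeasurable.add (hu.1.indicator measurableSet_Iio)
      ((aemeasurable_indicator_iff measurableSet_Iio.compl).2 (hu'.1.mono_measure ?_))
    rw [Measure.restrict_restrict measurableSet_Iio.compl]
    have hsub : (Iio τ)ᶜ ∩ Icc t Q.θ ⊆ Icc τ Q.θ := fun s hs => ⟨not_lt.1 hs.1, hs.2.2⟩
    exact Measure.restrict_mono hsub le_rfl
  · by_cases h : s ∈ Iio τ
    · rw [piecewise_eq_of_mem _ _ _ h]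
      exact hu.2 s hs
    · rw [piecewise_eq_of_notMem _ _ _ h]
      exact hu'.2 s ⟨not_lt.1 h, hs.2⟩

theorem isLocallyLipschitz_σ (hQ : Q.Standing) : Q.IsLocallyLipschitz fun _ => Q.σ := by
  intro α hα
  obtain ⟨L, hL, h⟩ := hQ.lip_σ α hα
  exact ⟨L, hL, fun _ _ => h⟩

/-- The costs of the motions that start in `P(α)` are uniformly bounded. -/
theorem exists_cost_bound (hQ : Q.Standing) {α : ℝ} (hα : 0 < α) : ∃ B, ∀ {t z w u x},
    t ∈ Icc Q.t₀ Q.θ → (z, w) ∈ P Q.h α → u ∈ Q.Controls t → Q.IsMotion t z w u x →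
      |Q.cost t u x| ≤ B := by
  have h0 := hQ.delay_pos
  obtain ⟨R, K, hαR, hK, hRK⟩ := exists_uniform_bounds hQ hα
  have hR : 0 < R := hα.trans_le hαR
  obtain ⟨L, hL, hσ⟩ := hQ.lip_σ R hR
  refine ⟨|Q.σ 0 0| + L * (R + Q.h * R) + K * (Q.θ - Q.t₀), ?_⟩
  intro t z w u x ht hzw hu hx
  obtain ⟨hb, hf, -⟩ := hRK ht hzw hu hx
  have hθ : Q.θ ∈ Icc t Q.θ := ⟨ht.2, le_rfl⟩
  have h1 := segment_mem_P hx.1.1 hQ hθ hb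
  have h2 : ((0 : EuclideanSpace ℝ (Fin n)), (0 : ℝ → EuclideanSpace ℝ (Fin n))) ∈ P Q.h R :=
    ⟨by simpa using hR.le, IsPC.of_continuousOn (by linarith) continuousOn_const,
      fun _ _ => by simpa using hR.le⟩
  have h3 := hσ _ _ _ _ h1 h2
  rw [sub_zero, sub_zero] at h3
  have h4 : |Q.σ (x Q.θ) (segment x Q.θ)| ≤ |Q.σ 0 0| + L * (R + Q.h * R) := by
    have h5 := abs_sub_abs_le_abs_sub (Q.σ (x Q.θ) (segment x Q.θ)) (Q.σ 0 0)
    have h6 := norm₁_le h1.2.1 h1.2.2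
    have h7 := mul_le_mul_of_nonneg_left (add_le_add h1.1 h6) hL.le
    linarith
  have h8 : |∫ ξ in t..Q.θ, Q.f₀ ξ (x ξ) (x (ξ - Q.h)) (u ξ)| ≤ K * (Q.θ - Q.t₀) := by
    have := intervalIntegral.norm_integral_le_of_norm_le_const (a := t) (b := Q.θ) (C := K)
      (f := fun ξ => Q.f₀ ξ (x ξ) (x (ξ - Q.h)) (u ξ)) (fun s hs => by
        rw [uIoc_of_le ht.2] at hs
        exact hf s ⟨hs.1.le, hs.2⟩)
    rw [abs_of_nonneg (sub_nonneg.2 ht.2)] at this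
    exact this.trans (by gcongr; exact ht.1)
  exact (abs_add_le _ _).trans (add_le_add h4 h8)

theorem value_le_cost (hQ : Q.Standing) (ht : t ∈ Icc Q.t₀ Q.θ) (hw : IsPC (-Q.h) 0 w)
    (hu : u ∈ Q.Controls t) (hx : Q.IsMotion t z w u x) : Q.value t z w ≤ Q.cost t u x := by
  obtain ⟨α, hα, hzw⟩ := exists_mem_P z hw
  obtain ⟨B, hB⟩ := exists_cost_bound hQ hα
  refine csInf_le ⟨-B, ?_⟩ ⟨u, hu, x, hx, rfl⟩
  rintro _ ⟨u, hu, x, hx, rfl⟩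
  exact (abs_le.1 (hB ht hzw hu hx)).1

theorem exists_cost_lt (hQ : Q.Standing) (ht : t ∈ Icc Q.t₀ Q.θ) (hw : IsPC (-Q.h) 0 w) {r : ℝ}
    (hr : Q.value t z w < r) :
    ∃ u ∈ Q.Controls t, ∃ x, Q.IsMotion t z w u x ∧ Q.cost t u x < r := by
  obtain ⟨v, hv⟩ := hQ.nonempty
  obtain ⟨x, hx⟩ := exists_isMotion hQ ht z hw (const_mem_Controls hv t)
  obtain ⟨_, ⟨u, hu, x, hx, rfl⟩, hlt⟩ := exists_lt_of_csInf_lt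
    (s := {r | ∃ u ∈ Q.Controls t, ∃ x, Q.IsMotion t z w u x ∧ r = Q.cost t u x})
    ⟨_, _, const_mem_Controls hv t, x, hx, rfl⟩ hr
  exact ⟨u, hu, x, hx, hlt⟩

theorem le_value (hQ : Q.Standing) (ht : t ∈ Icc Q.t₀ Q.θ) (hw : IsPC (-Q.h) 0 w) {r : ℝ}
    (hr : ∀ u ∈ Q.Controls t, ∀ x, Q.IsMotion t z w u x → r ≤ Q.cost t u x) :
    r ≤ Q.value t z w := by
  by_contra! h
  obtain ⟨u, hu, x, hx, hlt⟩ := exists_cost_lt hQ ht hw h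
  exact absurd (hr u hu x hx) (not_le.2 hlt)

theorem isLocallyLipschitz_value (hQ : Q.Standing) : Q.IsLocallyLipschitz Q.value := by
  intro α hα
  have h0 := hQ.delay_pos
  have hT : 0 < Q.θ - Q.t₀ := sub_pos.2 hQ.time_lt
  obtain ⟨R, K, hαR, hK, hRK⟩ := exists_uniform_bounds hQ hα
  obtain ⟨C, hC0, hC⟩ := exists_dependence hQ hα
  have hR : 0 < R := hα.trans_le hαR
  obtain ⟨L, hL, hσ⟩ := hQ.lip_σ R hR
  obtain ⟨L', hL', hlip⟩ := hQ.lip R hR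
  set A := L * (C + (1 + C * (Q.θ - Q.t₀))) +
    L' * (C * (Q.θ - Q.t₀) + (1 + C * (Q.θ - Q.t₀))) with hA
  have hA0 : 0 < A := by positivity
  have main : ∀ t ∈ Icc Q.t₀ Q.θ, ∀ z w z' w', (z, w) ∈ P Q.h α → (z', w') ∈ P Q.h α →
      Q.value t z' w' ≤ Q.value t z w + A * (‖z - z'‖ + norm₁ Q.h (w - w')) := by
    intro t ht z w z' w' hzw hzw'
    rw [← sub_le_iff_le_add]
    refine le_value hQ ht hzw.2.1 fun u hu x hx => ?_
    obtain ⟨x', hx'⟩ := exists_isMotion hQ ht z' hzw'.2.1 hu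
    rw [sub_le_iff_le_add]
    refine (value_le_cost hQ ht hzw'.2.1 hu hx').trans ?_
    set δ := ‖z - z'‖ + norm₁ Q.h (w - w') with hδ
    have hδ0 : 0 ≤ δ := add_nonneg (norm_nonneg _) (norm₁_nonneg hQ _)
    have hb := (hRK ht hzw hu hx).1
    have hb' := (hRK ht hzw' hu hx').1
    have hθ : Q.θ ∈ Icc t Q.θ := ⟨ht.2, le_rfl⟩
    have hd := hC ht hzw hzw' hu hu hx hx' hθ (fun _ _ => rfl)
    have hp := hx.1.1.intervalIntegrable_norm_sub hx'.1.1
    have hpt := hp.mono_Icc (show t - Q.h ≤ t by linarith) ht.2 le_rfl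
    have hI : ∫ s in t..Q.θ, ‖x s - x' s‖ ≤ C * (Q.θ - Q.t₀) * δ := by
      have h1 := intervalIntegral.integral_mono_on ht.2 hpt
        (intervalIntegrable_const (c := C * δ)) hd
      rw [intervalIntegral.integral_const, smul_eq_mul] at h1
      have h2 : (Q.θ - t) * (C * δ) ≤ (Q.θ - Q.t₀) * (C * δ) := by gcongr; exact ht.1
      linarith
    have hw1 : norm₁ Q.h (w - w') ≤ δ := le_add_of_nonneg_left (norm_nonneg _)
    have hID : ∫ s in t..Q.θ, ‖x (s - Q.h) - x' (s - Q.h)‖ ≤ (1 + C * (Q.θ - Q.t₀)) * δ := by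
      have h1 := integral_delayed_le h0.le hp (fun s => norm_nonneg _) hθ
      rw [← norm₁_sub_eq_integral hQ hx.1.2.1 hx'.1.2.1] at h1
      linarith
    have hseg := norm₁_segment_sub_le hQ hx.1 hx'.1 hθ
    have h3 := hσ _ _ _ _ (segment_mem_P hx.1.1 hQ hθ hb) (segment_mem_P hx'.1.1 hQ hθ hb')
    have h4 : L * (‖x Q.θ - x' Q.θ‖ + norm₁ Q.h (segment x Q.θ - segment x' Q.θ)) ≤
        L * (C * δ + (1 + C * (Q.θ - Q.t₀)) * δ) := by
      have h5 := hd Q.θ hθ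
      refine mul_le_mul_of_nonneg_left (add_le_add h5 ?_) hL.le
      linarith
    have hi := intervalIntegrable_f₀ hQ ht hx.1.1 hu
    have hi' := intervalIntegrable_f₀ hQ ht hx'.1.1 hu
    have h6 : |(∫ s in t..Q.θ, Q.f₀ s (x s) (x (s - Q.h)) (u s)) -
        ∫ s in t..Q.θ, Q.f₀ s (x' s) (x' (s - Q.h)) (u s)| ≤
        ∫ s in t..Q.θ, L' * (‖x s - x' s‖ + ‖x (s - Q.h) - x' (s - Q.h)‖) := by
      rw [← intervalIntegral.integral_sub hi hi', ← Real.norm_eq_abs]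
      refine intervalIntegral.norm_integral_le_of_norm_le ht.2 (ae_of_all _ fun s hs => ?_)
        ((hpt.add (hp.delayed h0.le hθ)).const_mul L')
      have hs1 : s ∈ Icc (t - Q.h) Q.θ := ⟨by linarith [hs.1], hs.2⟩
      have hs2 : s - Q.h ∈ Icc (t - Q.h) Q.θ := ⟨by linarith [hs.1], by linarith [hs.2]⟩
      exact (le_add_of_nonneg_left (norm_nonneg _)).trans
        (hlip s ⟨ht.1.trans hs.1.le, hs.2⟩ _ _ _ _ (hb _ hs1) (hb _ hs2) (hb' _ hs1) (hb' _ hs2) _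
          (hu.2 s ⟨hs.1.le, hs.2⟩))
    rw [intervalIntegral.integral_const_mul,
      intervalIntegral.integral_add hpt (hp.delayed h0.le hθ)] at h6
    have h7 := mul_le_mul_of_nonneg_left (add_le_add hI hID) hL'.le
    have h8 := (abs_le.1 (h3.trans h4)).1
    have h9 := (abs_le.1 (h6.trans h7)).1
    rw [hA, cost, cost]
    linarith
  refine ⟨A, hA0, fun t ht z w z' w' hzw hzw' => abs_le.2 ⟨?_, ?_⟩⟩
  · have := main t ht z w z' w' hzw hzw'
    linarith
  · have := main t ht z' w' z w hzw' hzw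
    have h1 : norm₁ Q.h (w' - w) = norm₁ Q.h (w - w') := by
      simp only [norm₁, Pi.sub_apply, norm_sub_rev]
    rw [h1, norm_sub_rev] at this
    linarith

/-! ### The dynamic programming principle -/

theorem cost_eq_add (hQ : Q.Standing) (ht : t ∈ Icc Q.t₀ Q.θ) (hx : IsPC (t - Q.h) Q.θ x)
    (hu : u ∈ Q.Controls t) (hτ : τ ∈ Icc t Q.θ) :
    Q.cost t u x = Q.cost τ u x + ∫ s in t..τ, Q.f₀ s (x s) (x (s - Q.h)) (u s) := by
  have hi := intervalIntegrable_f₀ hQ ht hx hu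
  rw [cost, cost, ← intervalIntegral.integral_add_adjacent_intervals
    (hi.mono_Icc le_rfl hτ.1 hτ.2) (hi.mono_Icc hτ.1 hτ.2 le_rfl)]
  ring

theorem integral_f₀_congr (hQ : Q.Standing) (hτ : t ≤ τ) (hxx : EqOn x x' (Icc (t - Q.h) τ))
    (huu : EqOn u u' (Ico t τ)) :
    ∫ s in t..τ, Q.f₀ s (x s) (x (s - Q.h)) (u s) =
      ∫ s in t..τ, Q.f₀ s (x' s) (x' (s - Q.h)) (u' s) := by
  have h0 := hQ.delay_pos
  have h1 : ∀ᵐ s : ℝ, s ≠ τ := by simp [ae_iff, measure_singleton]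
  refine intervalIntegral.integral_congr_ae ?_
  filter_upwards [h1] with s hs hI
  rw [uIoc_of_le hτ] at hI
  rw [hxx ⟨by linarith [hI.1], hI.2⟩, hxx ⟨by linarith [hI.1], by linarith [hI.2]⟩,
    huu ⟨hI.1.le, lt_of_le_of_ne hI.2 hs⟩]

theorem segment_eqOn_of_eqOn {h : ℝ} {a : ℝ} (hxx : EqOn x x' (Icc a τ)) (ha : a ≤ τ - h) :
    EqOn (segment x τ) (segment x' τ) (Ico (-h) 0) := fun s hs =>
  hxx ⟨by linarith [hs.1], by linarith [hs.2]⟩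

theorem IsMotion.congr_init (hx : Q.IsMotion t z w u x) (hww : EqOn w w' (Ico (-Q.h) 0)) :
    Q.IsMotion t z w' u x :=
  ⟨⟨hx.1.1, fun s hs => (hx.1.2.1 s hs).trans (hww ⟨by linarith [hs.1], by linarith [hs.2]⟩),
    hx.1.2.2⟩, hx.2⟩

/-- The dynamic programming inequality: the value does not exceed the running cost along a motion
plus the value at its end. -/
theorem value_le_value_add (hQ : Q.Standing) (ht : t ∈ Icc Q.t₀ Q.θ) (hw : IsPC (-Q.h) 0 w)
    (hu : u ∈ Q.Controls t) (hx : Q.IsMotion t z w u x) (hτ : τ ∈ Icc t Q.θ) :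
    Q.value t z w ≤ Q.value τ (x τ) (segment x τ) +
      ∫ s in t..τ, Q.f₀ s (x s) (x (s - Q.h)) (u s) := by
  classical
  have h0 := hQ.delay_pos
  have hτ' : τ ∈ Icc Q.t₀ Q.θ := ⟨ht.1.trans hτ.1, hτ.2⟩
  have hseg := segment_isPC hx.1.1 hQ hτ
  rw [← sub_le_iff_le_add]
  refine le_value hQ hτ' hseg fun u' hu' x' hx' => ?_
  rw [sub_le_iff_le_add]
  -- The motion `y` of the concatenated control follows `x` up to `τ` and `x'` from then on.
  have hv := piecewise_mem_Controls hu hu'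
  set v := (Iio τ).piecewise u u' with hvdef
  have hvu : EqOn v u (Ico t τ) := fun s hs => piecewise_eq_of_mem _ _ _ hs.2
  have hvu' : EqOn v u' (Ico τ Q.θ) := fun s hs => piecewise_eq_of_notMem _ _ _ (not_lt.2 hs.1)
  obtain ⟨y, hy⟩ := exists_isMotion hQ ht z hw hv
  have hyx := hy.eqOn hx hQ ht hw hv hu hτ hvu
  have hy1 : Q.IsMotion τ (x τ) (segment x τ) v y := by
    have := (hy.restrict hQ hτ).congr_init
      (segment_eqOn_of_eqOn hyx (show t - Q.h ≤ τ - Q.h by linarith [hτ.1]))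
    rwa [hyx ⟨by linarith [hτ.1], le_rfl⟩] at this
  have hv' := mem_Controls_mono hv hτ.1
  have hθ : Q.θ ∈ Icc τ Q.θ := ⟨hτ.2, le_rfl⟩
  have hyx' := hy1.eqOn hx' hQ hτ' hseg hv' hu' hθ hvu'
  have hcost : Q.cost τ v y = Q.cost τ u' x' := by
    rw [cost, cost, integral_f₀_congr hQ hτ.2 hyx' hvu', hyx' ⟨by linarith [hτ.2], le_rfl⟩]
    congr 1
    exact (isLocallyLipschitz_σ hQ).congr hQ (t := Q.θ) ⟨hQ.time_lt.le, le_rfl⟩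
      (segment_isPC hy1.1.1 hQ hθ) (segment_isPC hx'.1.1 hQ hθ)
      (segment_eqOn_of_eqOn hyx' (by linarith [hτ.2]))
  rw [← hcost, ← integral_f₀_congr hQ hτ.1 hyx hvu, ← cost_eq_add hQ ht hy.1.1 hv hτ]
  exact value_le_cost hQ ht hw hv hy

end Value

/-! ### First-order expansion along motions -/

section Expansion

variable {n m : ℕ} {Q : Problem n m} {t τ p₀ : ℝ} {z y p : EuclideanSpace ℝ (Fin n)}
  {w x : ℝ → EuclideanSpace ℝ (Fin n)} {u : ℝ → EuclideanSpace ℝ (Fin m)}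
  {φ : ℝ → EuclideanSpace ℝ (Fin n) → (ℝ → EuclideanSpace ℝ (Fin n)) → ℝ}

/-- The function of the control value that is minimized in the Hamiltonian. -/
def preHamiltonian (Q : Problem n m) (t : ℝ) (x y s : EuclideanSpace ℝ (Fin n))
    (v : EuclideanSpace ℝ (Fin m)) : ℝ :=
  inner ℝ (Q.f t x y v) s + Q.f₀ t x y v

theorem continuousOn_f_control (hQ : Q.Standing) (ht : t ∈ Icc Q.t₀ Q.θ)
    (x y : EuclideanSpace ℝ (Fin n)) : ContinuousOn (fun v => Q.f t x y v) Q.U := by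
  have h : ContinuousOn (fun v : EuclideanSpace ℝ (Fin m) => (t, x, y, v)) Q.U :=
    Continuous.continuousOn (by fun_prop)
  exact hQ.cont_f.comp h fun v hv => ⟨ht, trivial, trivial, hv⟩

theorem continuousOn_f₀_control (hQ : Q.Standing) (ht : t ∈ Icc Q.t₀ Q.θ)
    (x y : EuclideanSpace ℝ (Fin n)) : ContinuousOn (fun v => Q.f₀ t x y v) Q.U := by
  have h : ContinuousOn (fun v : EuclideanSpace ℝ (Fin m) => (t, x, y, v)) Q.U :=
    Continuous.continuousOn (by fun_prop)
  exact hQ.cont_f₀.comp h fun v hv => ⟨ht, trivial, trivial, hv⟩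

theorem continuousOn_preHamiltonian (hQ : Q.Standing) (ht : t ∈ Icc Q.t₀ Q.θ)
    (x y s : EuclideanSpace ℝ (Fin n)) : ContinuousOn (Q.preHamiltonian t x y s) Q.U :=
  ((continuousOn_f_control hQ ht x y).inner continuousOn_const).add
    (continuousOn_f₀_control hQ ht x y)

/-- The minimum in the Hamiltonian is attained. -/
theorem exists_preHamiltonian_eq_H (hQ : Q.Standing) (ht : t ∈ Icc Q.t₀ Q.θ)
    (x y s : EuclideanSpace ℝ (Fin n)) : ∃ v ∈ Q.U, Q.preHamiltonian t x y s v = Q.H t x y s := by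
  obtain ⟨v, hv, hmin⟩ := hQ.compact.exists_isMinOn hQ.nonempty
    (continuousOn_preHamiltonian hQ ht x y s)
  refine ⟨v, hv, ?_⟩
  have : IsLeast (Q.preHamiltonian t x y s '' Q.U) (Q.preHamiltonian t x y s v) :=
    ⟨⟨v, hv, rfl⟩, by rintro _ ⟨v', hv', rfl⟩; exact hmin hv'⟩
  exact this.csInf_eq.symm

theorem H_le_preHamiltonian (hQ : Q.Standing) (ht : t ∈ Icc Q.t₀ Q.θ)
    (x y s : EuclideanSpace ℝ (Fin n)) {v : EuclideanSpace ℝ (Fin m)} (hv : v ∈ Q.U) :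
    Q.H t x y s ≤ Q.preHamiltonian t x y s v :=
  csInf_le (hQ.compact.image_of_continuousOn (continuousOn_preHamiltonian hQ ht x y s)).bddBelow
    ⟨v, hv, rfl⟩

theorem intervalIntegrable_comp_control {g : EuclideanSpace ℝ (Fin m) → ℝ} (hQ : Q.Standing)
    (ht : t ∈ Icc Q.t₀ Q.θ) (hg : ContinuousOn g Q.U) (hu : u ∈ Q.Controls t) :
    IntervalIntegrable (fun s => g (u s)) volume t Q.θ := by
  classical
  obtain ⟨C, hC⟩ := hQ.compact.exists_bound_of_continuousOn hg
  rw [intervalIntegrable_iff_integrableOn_Icc_of_le ht.2]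
  have h1 := hg.measurable_piecewise (continuousOn_const (c := (0 : ℝ))) hQ.compact.measurableSet
  refine Integrable.of_bound ((h1.comp_aemeasurable hu.1).congr ?_).aestronglyMeasurable C ?_
  · filter_upwards [ae_restrict_mem measurableSet_Icc] with s hs
    exact piecewise_eq_of_mem _ _ _ (hu.2 s hs)
  · filter_upwards [ae_restrict_mem measurableSet_Icc] with s hs using hC _ (hu.2 s hs)

/-- Near `(t, x₀, y₀)` a continuous function of the data is uniformly close to its value there, with
respect to the control. -/
theorem exists_uniform_nhds {G : Type*} [NormedAddCommGroup G]
    {F : ℝ → EuclideanSpace ℝ (Fin n) → EuclideanSpace ℝ (Fin n) → EuclideanSpace ℝ (Fin m) → G}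
    (hQ : Q.Standing) (ht : t ∈ Icc Q.t₀ Q.θ)
    (hF : ContinuousOn (fun p : ℝ × EuclideanSpace ℝ (Fin n) × EuclideanSpace ℝ (Fin n) ×
      EuclideanSpace ℝ (Fin m) => F p.1 p.2.1 p.2.2.1 p.2.2.2)
      (Icc Q.t₀ Q.θ ×ˢ univ ×ˢ univ ×ˢ Q.U)) (x₀ y₀ : EuclideanSpace ℝ (Fin n)) {ε : ℝ}
    (hε : 0 < ε) : ∃ r > 0, ∀ s ∈ Icc Q.t₀ Q.θ, ∀ x y, |s - t| < r → ‖x - x₀‖ < r → ‖y - y₀‖ < r →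
      ∀ v ∈ Q.U, ‖F s x y v - F t x₀ y₀ v‖ < ε := by
  have h1 : ContinuousOn (Function.uncurry
      (fun (q : ℝ × EuclideanSpace ℝ (Fin n) × EuclideanSpace ℝ (Fin n))
        (v : EuclideanSpace ℝ (Fin m)) => F q.1 q.2.1 q.2.2 v))
      ((Icc Q.t₀ Q.θ ×ˢ univ ×ˢ univ) ×ˢ Q.U) := by
    have hc : Continuous fun q : (ℝ × EuclideanSpace ℝ (Fin n) × EuclideanSpace ℝ (Fin n)) ×
        EuclideanSpace ℝ (Fin m) => (q.1.1, q.1.2.1, q.1.2.2, q.2) := by fun_prop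
    exact hF.comp hc.continuousOn fun q hq => ⟨hq.1.1, trivial, trivial, hq.2⟩
  obtain ⟨V, hV, h2⟩ := hQ.compact.mem_uniformity_of_prod (q := (t, x₀, y₀)) h1
    ⟨ht, trivial, trivial⟩ (Metric.dist_mem_uniformity hε)
  obtain ⟨r, hr, h3⟩ := Metric.mem_nhdsWithin_iff.1 hV
  refine ⟨r, hr, fun s hs x y h4 h5 h6 v hv => ?_⟩
  have := h2 (s, x, y) (h3 ⟨?_, hs, trivial, trivial⟩) v hv
  · simpa [dist_eq_norm] using this
  · rw [Metric.mem_ball, Prod.dist_eq, Prod.dist_eq, Real.dist_eq, dist_eq_norm, dist_eq_norm]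
    exact max_lt h4 (max_lt h5 h6)

/-- The right-hand side along all motions from `(t, z, w)` is uniformly close to the right-hand side
frozen at the initial point, because the motions are equi-Lipschitz and, up to time `t + h`, their
delayed values are given by `w`, which is continuous from the right at `-h`. -/
theorem exists_uniform_along {G : Type*} [NormedAddCommGroup G]
    {F : ℝ → EuclideanSpace ℝ (Fin n) → EuclideanSpace ℝ (Fin n) → EuclideanSpace ℝ (Fin m) → G}
    (hQ : Q.Standing) (ht : t ∈ Icc Q.t₀ Q.θ)
    (hF : ContinuousOn (fun p : ℝ × EuclideanSpace ℝ (Fin n) × EuclideanSpace ℝ (Fin n) ×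
      EuclideanSpace ℝ (Fin m) => F p.1 p.2.1 p.2.2.1 p.2.2.2)
      (Icc Q.t₀ Q.θ ×ˢ univ ×ˢ univ ×ˢ Q.U)) (hw : IsPC (-Q.h) 0 w)
    (z : EuclideanSpace ℝ (Fin n)) {ε : ℝ} (hε : 0 < ε) :
    ∃ δ > 0, ∀ u ∈ Q.Controls t, ∀ x, Q.IsMotion t z w u x → ∀ s ∈ Icc t Q.θ, s < t + δ →
      ‖F s (x s) (x (s - Q.h)) (u s) - F t z (w (-Q.h)) (u s)‖ < ε := by
  have h0 := hQ.delay_pos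
  obtain ⟨α, hα, hzw⟩ := exists_mem_P z hw
  obtain ⟨R, K, -, hK, hRK⟩ := exists_uniform_bounds hQ hα
  obtain ⟨r, hr, h1⟩ := exists_uniform_nhds hQ ht hF z (w (-Q.h)) hε
  obtain ⟨d, hd, h2⟩ := Metric.continuousWithinAt_iff.1
    (hw.continuousWithinAt ⟨le_rfl, neg_lt_zero.2 h0⟩) r hr
  refine ⟨min (min r (r / K)) (min d Q.h), by positivity, fun u hu x hx s hs hsδ => ?_⟩
  rw [← sub_lt_iff_lt_add', lt_min_iff, lt_min_iff, lt_min_iff] at hsδ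
  obtain ⟨⟨hs1, hs2⟩, hs3, hs4⟩ := hsδ
  have hst : 0 ≤ s - t := sub_nonneg.2 hs.1
  refine h1 s ⟨ht.1.trans hs.1, hs.2⟩ _ _ (by rwa [abs_of_nonneg hst]) ?_ ?_ _ (hu.2 s hs)
  · refine ((hRK ht hzw hu hx).2.2 s hs).trans_lt ?_
    rwa [lt_div_iff₀ hK, mul_comm] at hs2
  · rw [hx.1.2.1 _ ⟨by linarith, by linarith⟩, ← dist_eq_norm]
    refine h2 (show -Q.h ≤ s - Q.h - t by linarith) ?_
    rw [Real.dist_eq, show s - Q.h - t - -Q.h = s - t by ring, abs_of_nonneg hst]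
    exact hs3

/-- First-order expansion of a ci-differentiable functional along motions, with an error that is
uniform over all controls. The ci-derivative only concerns one continuation of `w` at a time; the
Lipschitz condition in `‖·‖₁` transfers the expansion from a fixed continuation to all motions,
whose segments differ from it by `O((τ - t)²)` in `‖·‖₁`. -/
theorem HasCIDerivAt.exists_uniform_expansion (hd : Q.HasCIDerivAt φ t z w p₀ p)
    (hφ : Q.IsLocallyLipschitz φ) (hQ : Q.Standing) (ht : t ∈ Icc Q.t₀ Q.θ)
    (hw : IsPC (-Q.h) 0 w) {ε : ℝ} (hε : 0 < ε) :
    ∃ δ > 0, ∀ u ∈ Q.Controls t, ∀ x, Q.IsMotion t z w u x → ∀ τ ∈ Icc t Q.θ, τ < t + δ →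
      |φ τ (x τ) (segment x τ) + (∫ s in t..τ, Q.f₀ s (x s) (x (s - Q.h)) (u s)) - φ t z w -
        ∫ s in t..τ, (p₀ + Q.preHamiltonian t z (w (-Q.h)) p (u s))| ≤ ε * (τ - t) := by
  have h0 := hQ.delay_pos
  obtain ⟨α, hα, hzw⟩ := exists_mem_P z hw
  obtain ⟨R, K, hαR, hK, hRK⟩ := exists_uniform_bounds hQ hα
  obtain ⟨L, hL, hlip⟩ := hφ R (hα.trans_le hαR)
  obtain ⟨v₀, hv₀⟩ := hQ.nonempty
  have hc₀ := const_mem_Controls (Q := Q) hv₀ t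
  obtain ⟨y, hy⟩ := exists_isMotion hQ ht z hw hc₀
  obtain ⟨hyb, -, hyK⟩ := hRK ht hzw hc₀ hy
  have hε1 : 0 < ε / 3 / (1 + K) := by positivity
  have hε2 : 0 < ε / 3 / (‖p‖ + 1) := by positivity
  obtain ⟨δ₁, hδ₁, hy1⟩ := Metric.mem_nhdsWithin_iff.1 ((hd y hy.1).def hε1)
  obtain ⟨δ₂, hδ₂, hf⟩ := exists_uniform_along hQ ht hQ.cont_f hw z hε2
  obtain ⟨δ₃, hδ₃, hf₀⟩ := exists_uniform_along hQ ht hQ.cont_f₀ hw z hε2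
  refine ⟨min (min δ₁ (δ₁ / K)) (min (min δ₂ δ₃) (ε / 3 / (L * (2 * K)))), by positivity, ?_⟩
  intro u hu x hx τ hτ hτδ
  rw [← sub_lt_iff_lt_add', lt_min_iff, lt_min_iff, lt_min_iff, lt_min_iff] at hτδ
  obtain ⟨⟨hτ1, hτ1'⟩, ⟨hτ2, hτ3⟩, hτ4⟩ := hτδ
  have hτt : 0 ≤ τ - t := sub_nonneg.2 hτ.1
  obtain ⟨hxb, -, hxK⟩ := hRK ht hzw hu hx
  have hτ' : τ ∈ Icc Q.t₀ Q.θ := ⟨ht.1.trans hτ.1, hτ.2⟩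
  -- The segment of `x` is replaced by that of the fixed continuation `y`.
  have hA : |φ τ (x τ) (segment x τ) - φ τ (x τ) (segment y τ)| ≤ ε / 3 * (τ - t) := by
    have h1 := hlip τ hτ' _ _ _ _ (segment_mem_P hx.1.1 hQ hτ hxb)
      (show (x τ, segment y τ) ∈ P Q.h R from
        ⟨(segment_mem_P hx.1.1 hQ hτ hxb).1, (segment_mem_P hy.1.1 hQ hτ hyb).2⟩)
    have h2 := norm₁_segment_sub_le hQ hx.1 hy.1 hτ
    rw [norm₁_sub_eq_zero hQ (fun _ _ => rfl), zero_add] at h2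
    have h3 := intervalIntegral.norm_integral_le_of_norm_le_const (a := t) (b := τ)
      (f := fun s => ‖x s - y s‖) (C := 2 * K * (τ - t)) (fun s hs => by
        rw [uIoc_of_le hτ.1] at hs
        have hsI : s ∈ Icc t Q.θ := ⟨hs.1.le, hs.2.trans hτ.2⟩
        rw [norm_norm, ← sub_sub_sub_cancel_right (x s) (y s) z]
        refine (norm_sub_le _ _).trans ((add_le_add (hxK s hsI) (hyK s hsI)).trans ?_)
        have : K * (s - t) ≤ K * (τ - t) := by gcongr; exact hs.2
        linarith)
    rw [abs_of_nonneg hτt] at h3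
    have h4 := h2.trans ((le_abs_self _).trans h3)
    rw [sub_self, norm_zero, zero_add] at h1
    have h5 := h1.trans (mul_le_mul_of_nonneg_left h4 hL.le)
    rw [lt_div_iff₀ (by positivity)] at hτ4
    have h6 := mul_le_mul_of_nonneg_right hτ4.le hτt
    linarith
  -- The ci-derivative gives the expansion for `y`, evaluated at the state `x τ`.
  have hB : |φ τ (x τ) (segment y τ) - φ t z w - (p₀ * (τ - t) + inner ℝ (x τ - z) p)| ≤
      ε / 3 * (τ - t) := by
    rcases hτ.1.eq_or_lt with rfl | hlt
    · have hxt : x t = z := hx.1.2.2.2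
      rw [hxt, hφ.congr hQ ht (segment_isPC hy.1.1 hQ hτ) hw (segment_eqOn hy.1)]
      simp
    · have h1 : (τ, x τ) ∈ Metric.ball (t, z) δ₁ := by
        rw [Metric.mem_ball, Prod.dist_eq, Real.dist_eq, dist_eq_norm, abs_of_nonneg hτt]
        refine max_lt hτ1 ((hxK τ hτ).trans_lt ?_)
        rwa [lt_div_iff₀ hK, mul_comm] at hτ1'
      have h2 := hy1 ⟨h1, ⟨hτ, trivial⟩, fun h => hlt.ne' (congrArg Prod.fst h)⟩
      simp only [mem_ofPred_eq, Real.norm_eq_abs] at h2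
      refine h2.trans ?_
      rw [abs_of_nonneg (add_nonneg (abs_nonneg _) (norm_nonneg _)), abs_of_nonneg hτt]
      calc _ ≤ ε / 3 / (1 + K) * ((τ - t) + K * (τ - t)) := by gcongr; exact hxK τ hτ
        _ = ε / 3 * (τ - t) := by field_simp
  -- The right-hand side is frozen at the initial point.
  have hif := (intervalIntegrable_f hQ ht hx.1.1 hu).mono_Icc le_rfl hτ.1 hτ.2
  have hif₀ := (intervalIntegrable_f₀ hQ ht hx.1.1 hu).mono_Icc le_rfl hτ.1 hτ.2
  have hifp : IntervalIntegrable (fun s => inner ℝ (Q.f s (x s) (x (s - Q.h)) (u s)) p)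
      volume t τ := by
    have : IntervalIntegrable (fun s => innerSL ℝ p (Q.f s (x s) (x (s - Q.h)) (u s))) volume t τ :=
      ⟨(innerSL ℝ p).integrable_comp hif.1, (innerSL ℝ p).integrable_comp hif.2⟩
    simpa only [innerSL_apply_apply, real_inner_comm] using this
  have hiH := (intervalIntegrable_comp_control hQ ht
    (continuousOn_preHamiltonian hQ ht z (w (-Q.h)) p) hu).mono_Icc le_rfl hτ.1 hτ.2
  have hinner : inner ℝ (x τ - z) p =
      ∫ s in t..τ, inner ℝ (Q.f s (x s) (x (s - Q.h)) (u s)) p := by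
    rw [hx.eq_add_integral hQ ht hu hτ, add_sub_cancel_left, real_inner_comm,
      ← innerSL_apply_apply ℝ, ← ContinuousLinearMap.intervalIntegral_comp_comm _ hif]
    simp only [innerSL_apply_apply, real_inner_comm]
  have hC : |(∫ s in t..τ, (inner ℝ (Q.f s (x s) (x (s - Q.h)) (u s)) p +
      Q.f₀ s (x s) (x (s - Q.h)) (u s) - Q.preHamiltonian t z (w (-Q.h)) p (u s)))| ≤
      ε / 3 * (τ - t) := by
    rw [← abs_of_nonneg hτt, ← Real.norm_eq_abs]
    refine intervalIntegral.norm_integral_le_of_norm_le_const fun s hs => ?_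
    rw [uIoc_of_le hτ.1] at hs
    have hsI : s ∈ Icc t Q.θ := ⟨hs.1.le, hs.2.trans hτ.2⟩
    have h1 := (hf u hu x hx s hsI (by linarith [hs.2])).le
    have h2 := (hf₀ u hu x hx s hsI (by linarith [hs.2])).le
    have h3 : inner ℝ (Q.f s (x s) (x (s - Q.h)) (u s)) p + Q.f₀ s (x s) (x (s - Q.h)) (u s) -
        Q.preHamiltonian t z (w (-Q.h)) p (u s) =
        inner ℝ (Q.f s (x s) (x (s - Q.h)) (u s) - Q.f t z (w (-Q.h)) (u s)) p +
        (Q.f₀ s (x s) (x (s - Q.h)) (u s) - Q.f₀ t z (w (-Q.h)) (u s)) := by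
      rw [preHamiltonian, inner_sub_left]; ring
    rw [h3]
    calc _ ≤ ε / 3 / (‖p‖ + 1) * ‖p‖ + ε / 3 / (‖p‖ + 1) := by
          refine (norm_add_le _ _).trans (add_le_add ((norm_inner_le_norm _ _).trans ?_) h2)
          gcongr
      _ = ε / 3 := by field_simp
  rw [intervalIntegral.integral_sub (hifp.add hif₀) hiH, intervalIntegral.integral_add hifp hif₀,
    ← hinner] at hC
  rw [intervalIntegral.integral_add intervalIntegrable_const hiH, intervalIntegral.integral_const,
    smul_eq_mul]
  have hA' := abs_le.1 hA
  have hB' := abs_le.1 hB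
  have hC' := abs_le.1 hC
  rw [abs_le]
  constructor <;> linarith [hA'.1, hA'.2, hB'.1, hB'.2, hC'.1, hC'.2]

/-- Lower bound for the frozen integral by the Hamiltonian. -/
theorem le_integral_preHamiltonian (hQ : Q.Standing) (ht : t ∈ Icc Q.t₀ Q.θ)
    (hu : u ∈ Q.Controls t) (hτ : τ ∈ Icc t Q.θ) :
    (p₀ + Q.H t z y p) * (τ - t) ≤ ∫ s in t..τ, (p₀ + Q.preHamiltonian t z y p (u s)) := by
  have hiH := (intervalIntegrable_comp_control hQ ht
    (continuousOn_preHamiltonian hQ ht z y p) hu).mono_Icc le_rfl hτ.1 hτ.2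
  have := intervalIntegral.integral_mono_on hτ.1
    (intervalIntegrable_const (c := p₀ + Q.H t z y p))
    ((intervalIntegrable_const (c := p₀)).add hiH) (fun s hs =>
      (add_le_add_iff_left p₀).2
        (H_le_preHamiltonian hQ ht z y p (hu.2 s ⟨hs.1, hs.2.trans hτ.2⟩)))
  rw [intervalIntegral.integral_const, smul_eq_mul] at this
  linarith

/-- Where the value functional is ci-differentiable, it satisfies the HJB equation. -/
theorem value_satisfiesHJBAt (hQ : Q.Standing) (ht : t ∈ Icc Q.t₀ Q.θ) (htθ : t < Q.θ)
    (hw : IsPC (-Q.h) 0 w) : Q.SatisfiesHJBAt Q.value t z w := by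
  intro p₀ p hd
  have hexp := fun {ε : ℝ} (hε : 0 < ε) =>
    hd.exists_uniform_expansion (isLocallyLipschitz_value hQ) hQ ht hw hε
  apply le_antisymm
  · -- Controls that are optimal up to `ε / 2 * (τ - t)` make the frozen integral small.
    refine le_of_forall_pos_le_add fun ε hε => ?_
    obtain ⟨δ, hδ, h1⟩ := hexp (half_pos hε)
    set τ := t + min (δ / 2) (Q.θ - t) with hτdef
    have hmin : 0 < min (δ / 2) (Q.θ - t) := lt_min (half_pos hδ) (sub_pos.2 htθ)
    have hτ : τ ∈ Icc t Q.θ :=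
      ⟨by linarith, by linarith [min_le_right (δ / 2) (Q.θ - t)]⟩
    have hτδ : τ < t + δ := by linarith [min_le_left (δ / 2) (Q.θ - t)]
    have hτt : 0 < τ - t := by linarith
    obtain ⟨u, hu, x, hx, hlt⟩ := exists_cost_lt (z := z) hQ ht hw
      (show Q.value t z w < Q.value t z w + ε / 2 * (τ - t) by
        have := mul_pos (half_pos hε) hτt; linarith)
    have h2 := (abs_le.1 (h1 u hu x hx τ hτ hτδ)).1
    have h3 := le_integral_preHamiltonian (p₀ := p₀) (z := z) (y := w (-Q.h)) (p := p) hQ ht hu hτ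
    rw [cost_eq_add hQ ht hx.1.1 hu hτ] at hlt
    have h4 := value_le_cost hQ ⟨ht.1.trans hτ.1, hτ.2⟩ (segment_isPC hx.1.1 hQ hτ)
      (mem_Controls_mono hu hτ.1) (hx.restrict hQ hτ)
    rw [zero_add]
    refine le_of_mul_le_mul_right (a := τ - t) ?_ hτt
    linarith
  · -- Along a constant control attaining the minimum, the frozen integral is `(p₀ + H) * (τ - t)`.
    refine le_of_forall_pos_le_add fun ε hε => ?_
    obtain ⟨δ, hδ, h1⟩ := hexp hε
    set τ := t + min (δ / 2) (Q.θ - t) with hτdef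
    have hmin : 0 < min (δ / 2) (Q.θ - t) := lt_min (half_pos hδ) (sub_pos.2 htθ)
    have hτ : τ ∈ Icc t Q.θ :=
      ⟨by linarith, by linarith [min_le_right (δ / 2) (Q.θ - t)]⟩
    have hτδ : τ < t + δ := by linarith [min_le_left (δ / 2) (Q.θ - t)]
    have hτt : 0 < τ - t := by linarith
    obtain ⟨v, hv, hvH⟩ := exists_preHamiltonian_eq_H hQ ht z (w (-Q.h)) p
    have hu := const_mem_Controls (Q := Q) hv t
    obtain ⟨x, hx⟩ := exists_isMotion hQ ht z hw hu
    have h2 := (abs_le.1 (h1 _ hu x hx τ hτ hτδ)).2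
    have h3 := value_le_value_add hQ ht hw hu hx hτ
    simp only [hvH, intervalIntegral.integral_const, smul_eq_mul] at h2
    refine le_of_mul_le_mul_right (a := τ - t) ?_ hτt
    linarith

end Expansion

/-! ### Verification: ci-smooth solutions coincide with the value functional -/

section Verification

variable {n m : ℕ} {Q : Problem n m} {t τ : ℝ} {z : EuclideanSpace ℝ (Fin n)}
  {w x x' : ℝ → EuclideanSpace ℝ (Fin n)} {u u' : ℝ → EuclideanSpace ℝ (Fin m)}
  {φ : ℝ → EuclideanSpace ℝ (Fin n) → (ℝ → EuclideanSpace ℝ (Fin n)) → ℝ}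

/-- Continuity of translation in `‖·‖₁` along a piecewise continuous function. -/
theorem tendsto_norm₁_segment_sub (hQ : Q.Standing) (hx : IsPC (t - Q.h) Q.θ x)
    (hτ : τ ∈ Icc t Q.θ) :
    Tendsto (fun s => norm₁ Q.h (segment x s - segment x τ)) (𝓝[Icc t Q.θ] τ) (𝓝 0) := by
  have h0 := hQ.delay_pos
  obtain ⟨C, hC⟩ := hx.bounded
  have hmem : ∀ s ∈ Icc t Q.θ, ∀ ξ ∈ Ioc (-Q.h) 0, s + ξ ∈ Icc (t - Q.h) Q.θ := fun s hs ξ hξ =>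
    ⟨by linarith [hs.1, hξ.1], by linarith [hs.2, hξ.2]⟩
  have hlim : Tendsto (fun s => ∫ ξ in (-Q.h)..0, ‖x (s + ξ) - x (τ + ξ)‖) (𝓝[Icc t Q.θ] τ)
      (𝓝 (∫ _ in (-Q.h)..0, (0 : ℝ))) := by
    refine intervalIntegral.tendsto_integral_filter_of_dominated_convergence (fun _ => C + C)
      ?_ ?_ intervalIntegrable_const ?_
    · filter_upwards [self_mem_nhdsWithin] with s hs
      have hi := (segment_isPC hx hQ hs).intervalIntegrable_norm_sub (segment_isPC hx hQ hτ)
      rw [uIoc_of_le (by linarith)]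
      exact hi.1.aestronglyMeasurable
    · filter_upwards [self_mem_nhdsWithin] with s hs
      refine ae_of_all _ fun ξ hξ => ?_
      rw [uIoc_of_le (by linarith)] at hξ
      rw [norm_norm]
      exact (norm_sub_le _ _).trans
        (add_le_add (hC _ (hmem s hs ξ hξ)) (hC _ (hmem τ hτ ξ hξ)))
    · have hc : ∀ᵐ ξ : ℝ, τ + ξ ∈ Icc (t - Q.h) Q.θ → ContinuousAt x (τ + ξ) :=
        (measurePreserving_add_left volume τ).quasiMeasurePreserving.ae hx.ae_continuousAt
      filter_upwards [hc] with ξ h1 hξ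
      rw [uIoc_of_le (by linarith)] at hξ
      have h2 : Tendsto (fun s => s + ξ) (𝓝 τ) (𝓝 (τ + ξ)) :=
        (by fun_prop : Continuous fun s : ℝ => s + ξ).tendsto _
      have h3 := ((h1 (hmem τ hτ ξ hξ)).tendsto.comp h2).sub_const (x (τ + ξ)) |>.norm
      rw [sub_self, norm_zero] at h3
      exact h3.mono_left nhdsWithin_le_nhds
  rw [intervalIntegral.integral_zero] at hlim
  exact hlim

theorem MemPhi.continuousOn_along (hφ : Q.MemPhi φ) (hQ : Q.Standing) (ht : t ∈ Icc Q.t₀ Q.θ)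
    (hx : x ∈ Q.Lam t z w) : ContinuousOn (fun τ => φ τ (x τ) (segment x τ)) (Icc t Q.θ) := by
  intro τ hτ
  have h0 := hQ.delay_pos
  obtain ⟨C, hC⟩ := hx.1.bounded
  set R := max 1 C
  have hR : ∀ s ∈ Icc (t - Q.h) Q.θ, ‖x s‖ ≤ R := fun s hs => (hC s hs).trans (le_max_right _ _)
  obtain ⟨L, hL, hlip⟩ := hφ.lip R (by positivity)
  have h1 : Tendsto (fun s => φ s (x τ) (segment x τ)) (𝓝[Icc t Q.θ] τ)
      (𝓝 (φ τ (x τ) (segment x τ))) :=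
    (hφ.cont (x τ) (segment x τ) (segment_isPC hx.1 hQ hτ) τ ⟨ht.1.trans hτ.1, hτ.2⟩).mono
      (Icc_subset_Icc_left ht.1)
  have h2 : Tendsto (fun s => φ s (x s) (segment x s) - φ s (x τ) (segment x τ)) (𝓝[Icc t Q.θ] τ)
      (𝓝 0) := by
    have h3 : Tendsto (fun s => L * (‖x s - x τ‖ + norm₁ Q.h (segment x s - segment x τ)))
        (𝓝[Icc t Q.θ] τ) (𝓝 0) := by
      have h4 := ((continuousOn_of_mem_Lam hx τ hτ).tendsto.sub_const (x τ)).norm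
      rw [sub_self, norm_zero] at h4
      simpa using (h4.add (tendsto_norm₁_segment_sub hQ hx.1 hτ)).const_mul L
    refine squeeze_zero_norm' ?_ h3
    filter_upwards [self_mem_nhdsWithin] with s hs
    exact hlip s ⟨ht.1.trans hs.1, hs.2⟩ _ _ _ _ (segment_mem_P hx.1 hQ hs hR)
      (segment_mem_P hx.1 hQ hτ hR)
  have := h2.add h1
  simpa [ContinuousWithinAt] using this

/-- The running cost on `[t, τ]` plus the value of `φ` at the position at time `τ`. -/
def costUpTo (Q : Problem n m)
    (φ : ℝ → EuclideanSpace ℝ (Fin n) → (ℝ → EuclideanSpace ℝ (Fin n)) → ℝ) (t : ℝ)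
    (u : ℝ → EuclideanSpace ℝ (Fin m)) (x : ℝ → EuclideanSpace ℝ (Fin n)) (τ : ℝ) : ℝ :=
  φ τ (x τ) (segment x τ) + ∫ s in t..τ, Q.f₀ s (x s) (x (s - Q.h)) (u s)

theorem continuousOn_costUpTo (hφ : Q.MemPhi φ) (hQ : Q.Standing) (ht : t ∈ Icc Q.t₀ Q.θ)
    (hx : x ∈ Q.Lam t z w) (hu : u ∈ Q.Controls t) :
    ContinuousOn (Q.costUpTo φ t u x) (Icc t Q.θ) := by
  have h1 := intervalIntegral.continuousOn_primitive_interval'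
    (intervalIntegrable_f₀ hQ ht hx.1 hu) left_mem_uIcc
  rw [uIcc_of_le ht.2] at h1
  exact (hφ.continuousOn_along hQ ht hx).add h1

theorem costUpTo_sub (hQ : Q.Standing) (ht : t ∈ Icc Q.t₀ Q.θ) (hx : IsPC (t - Q.h) Q.θ x)
    (hu : u ∈ Q.Controls t) {s : ℝ} (hτ : t ≤ τ) (hτs : τ ≤ s) (hs : s ≤ Q.θ) :
    Q.costUpTo φ t u x s - Q.costUpTo φ t u x τ =
      Q.costUpTo φ τ u x s - φ τ (x τ) (segment x τ) := by
  have hi := intervalIntegrable_f₀ hQ ht hx hu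
  rw [costUpTo, costUpTo, costUpTo, ← intervalIntegral.integral_add_adjacent_intervals
    (hi.mono_Icc le_rfl hτ (hτs.trans hs)) (hi.mono_Icc hτ hτs hs)]
  ring

theorem costUpTo_congr (hφ : Q.IsLocallyLipschitz φ) (hQ : Q.Standing) (ht : t ∈ Icc Q.t₀ Q.θ)
    (hx : IsPC (t - Q.h) Q.θ x) (hx' : IsPC (t - Q.h) Q.θ x') (hτ : τ ∈ Icc t Q.θ)
    (hxx : EqOn x x' (Icc (t - Q.h) τ)) (huu : EqOn u u' (Ico t τ)) :
    Q.costUpTo φ t u x τ = Q.costUpTo φ t u' x' τ := by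
  rw [costUpTo, costUpTo, integral_f₀_congr hQ hτ.1 hxx huu,
    hxx ⟨by linarith [hτ.1, hQ.delay_pos], le_rfl⟩,
    hφ.congr hQ ⟨ht.1.trans hτ.1, hτ.2⟩ (segment_isPC hx hQ hτ) (segment_isPC hx' hQ hτ)
      (segment_eqOn_of_eqOn hxx (by linarith [hτ.1]))]

theorem costUpTo_left (hφ : Q.IsLocallyLipschitz φ) (hQ : Q.Standing) (ht : t ∈ Icc Q.t₀ Q.θ)
    (hw : IsPC (-Q.h) 0 w) (hx : x ∈ Q.Lam t z w) : Q.costUpTo φ t u x t = φ t z w := by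
  rw [costUpTo, intervalIntegral.integral_same, add_zero, hx.2.2.2,
    hφ.congr hQ ht (segment_isPC hx.1 hQ ⟨le_rfl, ht.2⟩) hw (segment_eqOn hx)]

theorem costUpTo_right (hφ : Q.TerminalCondition φ) (hQ : Q.Standing) (ht : t ∈ Icc Q.t₀ Q.θ)
    (hx : x ∈ Q.Lam t z w) : Q.costUpTo φ t u x Q.θ = Q.cost t u x := by
  rw [costUpTo, cost,
    hφ _ _ ⟨⟨hQ.time_lt.le, le_rfl⟩, segment_isPC hx.1 hQ ⟨ht.2, le_rfl⟩⟩]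

/-- A ci-smooth solution of the HJB equation is nondecreasing along motions, up to running cost: by
the HJB equation all lower right Dini derivatives are nonnegative. -/
theorem le_cost_of_HJB (hφ : Q.MemPhi φ)
    (hHJB : ∀ t z w, Q.InG t z w → t < Q.θ → Q.CIDifferentiableAt φ t z w ∧ Q.SatisfiesHJBAt φ t z w)
    (hterm : Q.TerminalCondition φ) (hQ : Q.Standing) (ht : t ∈ Icc Q.t₀ Q.θ)
    (hw : IsPC (-Q.h) 0 w) (hu : u ∈ Q.Controls t) (hx : Q.IsMotion t z w u x) :
    φ t z w ≤ Q.cost t u x := by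
  have hlip : Q.IsLocallyLipschitz φ := hφ.lip
  have hcont := (continuousOn_costUpTo hφ hQ ht hx.1 hu).neg
  have key := image_le_of_liminf_slope_right_le_deriv_boundary hcont
    (B := fun _ => -Q.costUpTo φ t u x t) (B' := fun _ => 0) le_rfl continuousOn_const
    (fun τ _ => hasDerivWithinAt_const _ _ _) (by
      intro τ hτ r hr
      have hτ' : τ ∈ Icc t Q.θ := Ico_subset_Icc_self hτ
      have hτQ : τ ∈ Icc Q.t₀ Q.θ := ⟨ht.1.trans hτ.1, hτ'.2⟩
      have hseg := segment_isPC hx.1.1 hQ hτ'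
      obtain ⟨⟨p₀, p, hd⟩, hH⟩ := hHJB τ (x τ) (segment x τ) ⟨hτQ, hseg⟩ hτ.2
      obtain ⟨δ, hδ, h1⟩ := hd.exists_uniform_expansion hlip hQ hτQ hseg (half_pos hr)
      refine Eventually.frequently ?_
      filter_upwards [Ioo_mem_nhdsGT (lt_min hτ.2 (lt_add_of_pos_right τ hδ))] with s hs
      have hs1 := hs.2.trans_le (min_le_left _ _)
      have hs2 := hs.2.trans_le (min_le_right _ _)
      have hsI : s ∈ Icc τ Q.θ := ⟨hs.1.le, hs1.le⟩
      have hu' := mem_Controls_mono hu hτ.1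
      have h2 := (abs_le.1 (h1 u hu' x (hx.restrict hQ hτ') s hsI hs2)).1
      have h3 := le_integral_preHamiltonian (p₀ := p₀) (z := x τ) (y := segment x τ (-Q.h)) (p := p)
        hQ hτQ hu' hsI
      rw [hH p₀ p hd, zero_mul] at h3
      have h4 := costUpTo_sub (φ := φ) hQ ht hx.1.1 hu hτ.1 hs.1.le hs1.le
      rw [costUpTo] at h4
      have h5 : 0 < s - τ := sub_pos.2 hs.1
      rw [slope_def_field, div_lt_iff₀ h5]
      simp only [costUpTo, Pi.neg_apply] at h4 ⊢
      nlinarith)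
  have h1 := neg_le_neg_iff.1 (key (right_mem_Icc.2 ht.2))
  rwa [costUpTo_left hlip hQ ht hw hx.1, costUpTo_right hterm hQ ht hx.1] at h1

/-- Controls that coincide with the members of a sequence of controls on longer and longer time
intervals. -/
theorem exists_limit_control {v : ℕ → ℝ → EuclideanSpace ℝ (Fin m)} {σ : ℕ → ℝ}
    (hv : ∀ k, v k ∈ Q.Controls t) (hvv : ∀ k l, k ≤ l → EqOn (v k) (v l) (Iio (σ k)))
    (hσ : Monotone σ) (hσt : ∀ k, t ≤ σ k) : ∃ u ∈ Q.Controls t, ∀ k, EqOn (v k) u (Iio (σ k)) := by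
  classical
  let u : ℝ → EuclideanSpace ℝ (Fin m) := fun s =>
    if hs : ∃ k, s < σ k then v (Nat.find hs) s else v 0 s
  have hu : ∀ k, EqOn (v k) u (Iio (σ k)) := by
    intro k s hs
    have hex : ∃ k, s < σ k := ⟨k, hs⟩
    simp only [u, dif_pos hex]
    exact (hvv _ _ (Nat.find_min' hex hs) (Nat.find_spec hex)).symm
  refine ⟨u, ⟨?_, fun s hs => ?_⟩, hu⟩
  · have hw : ∀ k, (Iio (σ k)).piecewise (v k) (v 0) ∈ Q.Controls t := fun k =>
      piecewise_mem_Controls (hv k) (mem_Controls_mono (hv 0) (hσt k))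
    refine aemeasurable_of_tendsto_metrizable_ae' (fun k => (hw k).1) (ae_of_all _ fun s => ?_)
    refine tendsto_const_nhds.congr' ?_
    by_cases hex : ∃ k, s < σ k
    · obtain ⟨k, hk⟩ := hex
      filter_upwards [eventually_ge_atTop k] with l hl
      have hl' : s ∈ Iio (σ l) := lt_of_lt_of_le hk (hσ hl)
      rw [piecewise_eq_of_mem _ _ _ hl', hu l hl']
    · refine Eventually.of_forall fun l => ?_
      have hl : s ∉ Iio (σ l) := fun h => hex ⟨l, h⟩
      change u s = (Iio (σ l)).piecewise (v l) (v 0) s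
      rw [piecewise_eq_of_notMem _ _ _ hl]
      simp only [u, dif_neg hex]
  · by_cases hex : ∃ k, s < σ k
    · simp only [u, dif_pos hex]; exact (hv _).2 s hs
    · simp only [u, dif_neg hex]; exact (hv 0).2 s hs

/-- Near-optimal controls exist for a ci-smooth solution of the HJB equation. As no continuity of
the ci-derivatives is assumed, the step over which a minimizing constant control may be used depends
on the position; the steps are exhausted by the maximality principle, whose limit step is
`exists_limit_control`. -/
theorem exists_cost_le_of_HJB (hφ : Q.MemPhi φ)
    (hHJB : ∀ t z w, Q.InG t z w → t < Q.θ → Q.CIDifferentiableAt φ t z w ∧ Q.SatisfiesHJBAt φ t z w)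
    (hterm : Q.TerminalCondition φ) (hQ : Q.Standing) (ht : t ∈ Icc Q.t₀ Q.θ)
    (hw : IsPC (-Q.h) 0 w) {ε : ℝ} (hε : 0 < ε) :
    ∃ u ∈ Q.Controls t, ∃ x, Q.IsMotion t z w u x ∧ Q.cost t u x ≤ φ t z w + ε * (Q.θ - t) := by
  classical
  have h0 := hQ.delay_pos
  have hlip : Q.IsLocallyLipschitz φ := hφ.lip
  have hex : ∀ u : Q.Controls t, ∃ x, Q.IsMotion t z w u x := fun u =>
    exists_isMotion hQ ht z hw u.2
  choose X hX using hex
  -- `κ u` depends on `u` only causally. The order `r` below extends a control from `τ` on without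
  -- increasing `κ`; the term `ε * (τ - t)` absorbs the error of the first-order expansion.
  let κ : Q.Controls t → ℝ → ℝ := fun u τ => Q.costUpTo φ t u (X u) τ - ε * (τ - t)
  have hκc : ∀ u, ContinuousOn (κ u) (Icc t Q.θ) := fun u =>
    (continuousOn_costUpTo hφ hQ ht (hX u).1 u.2).sub (by fun_prop)
  have hκ : ∀ u v : Q.Controls t, ∀ τ ∈ Icc t Q.θ, EqOn u.1 v.1 (Iio τ) → κ u τ = κ v τ := by
    intro u v τ hτ huv
    have huv' : EqOn u.1 v.1 (Ico t τ) := huv.mono fun s hs => hs.2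
    simp only [κ, costUpTo_congr hlip hQ ht (hX u).1.1 (hX v).1.1 hτ
      ((hX u).eqOn (hX v) hQ ht hw u.2 v.2 hτ huv') huv']
  obtain ⟨v₀, hv₀⟩ := hQ.nonempty
  let S := Icc t Q.θ × Q.Controls t
  let r : S → S → Prop := fun p q => p.1 ≤ q.1 ∧ EqOn p.2.1 q.2.1 (Iio (p.1 : ℝ)) ∧
    κ q.2 q.1 ≤ κ p.2 p.1
  obtain ⟨⟨τ, u⟩, hr, hmax⟩ := exists_forall_rel_le_of_sequences_bounded r (fun p => (p.1 : ℝ))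
    (θ := Q.θ) (fun p => ⟨le_rfl, fun _ _ => rfl, le_rfl⟩)
    (fun p q s h1 h2 => ⟨h1.1.trans h2.1,
      fun ξ hξ => (h1.2.1 hξ).trans (h2.2.1 (show ξ < (q.1 : ℝ) from lt_of_lt_of_le hξ h1.1)),
      h2.2.2.trans h1.2.2⟩)
    (fun p q h => h.1) (fun p => p.1.2.2)
    (by
      intro p hp
      have hσ : Monotone fun k => ((p k).1 : ℝ) := fun k l h => (hp k l h).1
      obtain ⟨u, hu, hpu⟩ := exists_limit_control (v := fun k => (p k).2.1)
        (σ := fun k => (p k).1) (fun k => (p k).2.2) (fun k l h => (hp k l h).2.1) hσ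
        fun k => (p k).1.2.1
      have hbdd : BddAbove (range fun k => ((p k).1 : ℝ)) :=
        ⟨Q.θ, by rintro _ ⟨k, rfl⟩; exact (p k).1.2.2⟩
      have hlim := tendsto_atTop_ciSup hσ hbdd
      set T := ⨆ k, ((p k).1 : ℝ)
      have hT : T ∈ Icc t Q.θ := isClosed_Icc.mem_of_tendsto hlim
        (Eventually.of_forall fun k => (p k).1.2)
      refine ⟨(⟨T, hT⟩, ⟨u, hu⟩), fun k => ⟨le_ciSup hbdd k, hpu k, ?_⟩⟩
      have hlim' : Tendsto (fun l => κ ⟨u, hu⟩ (p l).1) atTop (𝓝 (κ ⟨u, hu⟩ T)) :=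
        (hκc ⟨u, hu⟩ T hT).tendsto.comp
          (tendsto_nhdsWithin_iff.2 ⟨hlim, Eventually.of_forall fun l => (p l).1.2⟩)
      refine le_of_tendsto hlim' ?_
      filter_upwards [eventually_ge_atTop k] with l hl
      rw [← hκ (p l).2 ⟨u, hu⟩ _ (p l).1.2 (hpu l)]
      exact (hp k l hl).2.2)
    (⟨t, le_rfl, ht.2⟩, ⟨_, const_mem_Controls hv₀ t⟩)
  obtain ⟨τ, hτ⟩ := τ
  have hτθ : τ = Q.θ := by
    by_contra hne
    have hlt : τ < Q.θ := lt_of_le_of_ne hτ.2 hne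
    have hτQ : τ ∈ Icc Q.t₀ Q.θ := ⟨ht.1.trans hτ.1, hτ.2⟩
    have hseg := segment_isPC (hX u).1.1 hQ hτ
    obtain ⟨⟨p₀, p, hd⟩, hH⟩ := hHJB τ (X u τ) (segment (X u) τ) ⟨hτQ, hseg⟩ hlt
    obtain ⟨δ, hδ, h1⟩ := hd.exists_uniform_expansion hlip hQ hτQ hseg hε
    obtain ⟨v, hv, hvH⟩ := exists_preHamiltonian_eq_H hQ hτQ (X u τ) (segment (X u) τ (-Q.h)) p
    obtain ⟨u', huu', hu'v⟩ : ∃ u' : Q.Controls t, EqOn u.1 u'.1 (Iio τ) ∧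
        ∀ s, τ ≤ s → u'.1 s = v := by
      refine ⟨⟨(Iio τ).piecewise u.1 fun _ => v, piecewise_mem_Controls u.2
        (const_mem_Controls hv τ)⟩, (piecewise_eqOn _ _ _).symm, fun s hs => ?_⟩
      exact piecewise_eq_of_notMem (Iio τ) u.1 (fun _ => v) (not_lt.2 hs)
    have hXX := (hX u').eqOn (hX u) hQ ht hw u'.2 u.2 hτ fun s hs => (huu' hs.2).symm
    have hmot : Q.IsMotion τ (X u τ) (segment (X u) τ) u' (X u') := by
      have := ((hX u').restrict hQ hτ).congr_init
        (segment_eqOn_of_eqOn hXX (show t - Q.h ≤ τ - Q.h by linarith [hτ.1]))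
      rwa [hXX ⟨by linarith [hτ.1], le_rfl⟩] at this
    set s := τ + min (δ / 2) (Q.θ - τ) with hsdef
    have hmin : 0 < min (δ / 2) (Q.θ - τ) := lt_min (half_pos hδ) (sub_pos.2 hlt)
    have hsI : s ∈ Icc τ Q.θ := ⟨by linarith, by linarith [min_le_right (δ / 2) (Q.θ - τ)]⟩
    have hsδ : s < τ + δ := by linarith [min_le_left (δ / 2) (Q.θ - τ)]
    have h2 := (abs_le.1 (h1 _ (mem_Controls_mono u'.2 hτ.1) _ hmot s hsI hsδ)).2
    have h3 : ∫ ξ in τ..s, (p₀ + Q.preHamiltonian τ (X u τ) (segment (X u) τ (-Q.h)) p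
        (u'.1 ξ)) = 0 := by
      rw [← intervalIntegral.integral_zero (a := τ) (b := s)]
      refine intervalIntegral.integral_congr fun ξ hξ => ?_
      rw [uIcc_of_le hsI.1] at hξ
      have : u'.1 ξ = v := hu'v ξ hξ.1
      simp only [this, hvH]
      exact hH p₀ p hd
    rw [h3, sub_zero] at h2
    have h4 := costUpTo_sub (φ := φ) hQ ht (hX u').1.1 u'.2 hτ.1 hsI.1 hsI.2
    have hφτ : φ τ (X u' τ) (segment (X u') τ) = φ τ (X u τ) (segment (X u) τ) := by
      rw [hXX ⟨by linarith [hτ.1], le_rfl⟩]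
      exact hlip.congr hQ hτQ (segment_isPC (hX u').1.1 hQ hτ) hseg
        (segment_eqOn_of_eqOn hXX (by linarith [hτ.1]))
    rw [hφτ] at h4
    have h5 : κ u' s ≤ κ u τ := by
      rw [hκ u u' τ hτ huu']
      simp only [κ]
      have h6 : Q.costUpTo φ τ u' (X u') s - φ τ (X u τ) (segment (X u) τ) ≤ ε * (s - τ) := h2
      linarith
    have h7 := hmax (⟨s, hτ.1.trans hsI.1, hsI.2⟩, u') ⟨hsI.1, huu', h5⟩
    have h8 : s ≤ τ := h7
    linarith
  subst hτθ
  refine ⟨u, u.2, X u, hX u, ?_⟩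
  have h1 := hr.2.2
  simp only [κ, costUpTo_right hterm hQ ht (hX _).1, costUpTo_left hlip hQ ht hw (hX _).1,
    sub_self, mul_zero, sub_zero] at h1
  linarith

end Verification

end Problem

end DelayHJB

end

theorem theorem1 {n m : ℕ} (Q : DelayHJB.Problem n m) (hQ : Q.Standing) :
    (∀ φ : ℝ → EuclideanSpace ℝ (Fin n) → (ℝ → EuclideanSpace ℝ (Fin n)) → ℝ,
      Q.MemPhi φ →
      (∀ t z w, Q.InG t z w → t < Q.θ → Q.CIDifferentiableAt φ t z w ∧ Q.SatisfiesHJBAt φ t z w) →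
      Q.TerminalCondition φ →
      ∀ t z w, Q.InG t z w → φ t z w = Q.value t z w) ∧
    (∀ t z w, Q.InG t z w → t < Q.θ →
      Q.CIDifferentiableAt Q.value t z w → Q.SatisfiesHJBAt Q.value t z w) := by
  refine ⟨fun φ hφ hHJB hterm t z w hG => ?_, fun t z w hG htθ _ =>
    DelayHJB.Problem.value_satisfiesHJBAt hQ hG.1 htθ hG.2⟩
  obtain ⟨ht, hw⟩ := hG
  refine le_antisymm (DelayHJB.Problem.le_value hQ ht hw fun u hu x hx =>
    DelayHJB.Problem.le_cost_of_HJB hφ hHJB hterm hQ ht hw hu hx) ?_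
  refine le_of_forall_pos_le_add fun ε hε => ?_
  have hT : 0 < Q.θ - Q.t₀ := sub_pos.2 hQ.time_lt
  obtain ⟨u, hu, x, hx, hle⟩ := DelayHJB.Problem.exists_cost_le_of_HJB (z := z) hφ hHJB hterm hQ ht hw
    (div_pos hε hT)
  refine (DelayHJB.Problem.value_le_cost hQ ht hw hu hx).trans (hle.trans ?_)
  have h1 : ε / (Q.θ - Q.t₀) * (Q.θ - t) ≤ ε / (Q.θ - Q.t₀) * (Q.θ - Q.t₀) := by
    gcongr
    exact ht.1
  rw [div_mul_cancel₀ _ hT.ne'] at h1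
  linarith
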